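/- Let $\alpha\in\{1,2,\infty\}$ and let $\|\cdot\|_\alpha$ be the $\ell_\alpha$-norm. For $X\in\mathbb{R}^{m\times n}$ let $\sigma(X)\in\mathbb{R}_+^{\min\{m,n\}}$ be the vector of its singular values. (i) Let $\delta,\eta\ge 0$, $Y\in\mathbb{R}^{m\times n}$, and let $Y=U\,\mathrm{diag}(\sigma)V^T$ be a (thin) singular value decomposition, where $\sigma\in\mathbb{R}_+^r$ and $U\in\mathbb{R}^{m\times r}$, $V\in\mathbb{R}^{n\times r}$ have orthonormal columns. Then the constrained matrix shrinkage problem $$\min\{\delta\|\sigma(X)\|_\alpha+\tfrac12\|X-Y\|_F^2:\ \|\sigma(X)\|_\alpha\le\eta,\ X\in\mathbb{R}^{m\times n}\}$$ has a unique optimal solution $X^*$, the constrained vector shrinkage problem $$\min\{\delta\|s\|_\alpha+\tfrac12\|s-\sigma\|_2^2:\ \|s\|_\alpha\le\eta,\ s\in\mathbb{R}^r\}$$ has a unique optimal solution $s^*$, and $X^*=U\,\mathrm{diag}(s^*)V^T$. The complexity claims refer to programs on a real random access machine: exact real arithmetic $+,-,\times,/$, square roots and comparisons, and elementary index operations, cost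 one step each; one program, with integer constants only, serves all input sizes. The computation of an SVD of an $m\times n$ matrix is a subroutine charged $\Theta(\min\{n^2m,m^2n\})$ steps. (ii) Suppose that a program without SVD calls solves every $p$-dimensional constrained vector shrinkage problem $\min\{\delta\|s\|_\alpha+\frac12\|s-q\|_2^2:\ \|s\|_\alpha\le\eta,\ s\in\mathbb{R}^p\}$ (with $q\in\mathbb{R}^p$, $\delta,\eta\ge0$) in at most $T(p)$ steps. Then there are a program and a constant $C$ such that the program computes $X^*$, for all $m,n\ge1$, $Y\in\mathbb{R}^{m\times n}$, $\delta,\eta\ge0$ and every choice of the SVD subroutine, in at most $C\,(\min\{n^2m,m^2n\}+T(r))$ steps, where $r$ is the number of columns of $U$ in the SVD of $Y$ that the subroutine returns. (iii) For $\alpha=1$ and $\alpha=\infty$ there is such a program for the vector problem with $T(p)=\mathcal{O}(p\ln p)$, and for $\alpha=2$ there is one with $T(p)=\mathcal{O}(p)$. -/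

import Mathlib

/-! ## The shrinkage problems -/

/-- The `ℓ_α` norm on `ℝ^p`. -/
noncomputable def ellNorm (α : ENNReal) {p : ℕ} (s : Fin p → ℝ) : ℝ :=
  ‖(WithLp.toLp α s : PiLp α fun _ : Fin p => ℝ)‖

/-- The vector `σ(X) ∈ ℝ^{min(m,n)}` of singular values of `X`, in decreasing order. -/
noncomputable def singVals {m n : ℕ} (X : Matrix (Fin m) (Fin n) ℝ) : Fin (min m n) → ℝ :=
  fun i => (Matrix.toEuclideanLin X).singularValues i

/-- `Y = U diag(σ) Vᵀ` is a (thin) singular value decomposition of `Y` with `r` columns: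
`U` and `V` have orthonormal columns and `σ ≥ 0`. -/
structure IsSVD {m n r : ℕ} (Y : Matrix (Fin m) (Fin n) ℝ)
    (U : Matrix (Fin m) (Fin r) ℝ) (σ : Fin r → ℝ) (V : Matrix (Fin n) (Fin r) ℝ) : Prop where
  left_orthonormal : U.transpose * U = 1
  right_orthonormal : V.transpose * V = 1
  nonneg : ∀ i, 0 ≤ σ i
  eq : Y = U * Matrix.diagonal σ * V.transpose

/-- The vector objective `δ ‖s‖_α + ½ ‖s - q‖₂²`. -/
noncomputable def vecObj (α : ENNReal) (δ : ℝ) {p : ℕ} (q s : Fin p → ℝ) : ℝ :=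
  δ * ellNorm α s + 1 / 2 * ∑ i, (s i - q i) ^ 2

/-- `s` is an optimal solution of `min {δ ‖s‖_α + ½ ‖s - q‖₂² : ‖s‖_α ≤ η}`. -/
def IsVecSol (α : ENNReal) (δ η : ℝ) {p : ℕ} (q s : Fin p → ℝ) : Prop :=
  ellNorm α s ≤ η ∧ ∀ s' : Fin p → ℝ, ellNorm α s' ≤ η → vecObj α δ q s ≤ vecObj α δ q s'

/-- The matrix objective `δ ‖σ(X)‖_α + ½ ‖X - Y‖_F²`. -/
noncomputable def matObj (α : ENNReal) (δ : ℝ) {m n : ℕ} (Y X : Matrix (Fin m) (Fin n) ℝ) : ℝ :=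
  δ * ellNorm α (singVals X) + 1 / 2 * ∑ i, ∑ j, (X i j - Y i j) ^ 2

/-- `X` is an optimal solution of `min {δ ‖σ(X)‖_α + ½ ‖X - Y‖_F² : ‖σ(X)‖_α ≤ η}`. -/
def IsMatSol (α : ENNReal) (δ η : ℝ) {m n : ℕ} (Y X : Matrix (Fin m) (Fin n) ℝ) : Prop :=
  ellNorm α (singVals X) ≤ η ∧
    ∀ X' : Matrix (Fin m) (Fin n) ℝ, ellNorm α (singVals X') ≤ η →
      matObj α δ Y X ≤ matObj α δ Y X'

/-! ## Real random access machine

A structured real RAM: natural number registers (used as counters and addresses), real registers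
and real arrays, with exact real arithmetic `+ - * /`, square root and comparison at unit cost.
A program is one finite text, used for all input sizes; its only constants are integers. -/

namespace RealRAM

/-- Memory: natural number registers, real registers, and real arrays (array `a`, cell `i`). -/
structure State where
  nat : ℕ → ℕ
  real : ℕ → ℝ
  arr : ℕ → ℕ → ℝ

/-- Address expressions (no multiplication). -/
inductive NExp where
  | const (k : ℕ)
  | reg (i : ℕ)
  | add (e f : NExp)
  | sub (e f : NExp)
  | half (e : NExp)

/-- Real expressions. -/
inductive RExp where
  | const (k : ℤ)
  | reg (i : ℕ)
  | get (a : ℕ) (i : NExp)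
  | add (e f : RExp)
  | sub (e f : RExp)
  | mul (e f : RExp)
  | div (e f : RExp)
  | sqrt (e : RExp)

/-- Comparisons. -/
inductive Cmp where
  | natLT (e f : NExp)
  | realLT (e f : RExp)

/-- Programs. `svd m n r a u s v` is the call of an SVD routine: it reads the dimensions from the
natural registers `m`, `n` and the matrix from array `a`, and writes the number of columns to the
natural register `r` and the three factors to the arrays `u`, `s`, `v`. -/
inductive Cmd where
  | skip
  | setNat (i : ℕ) (e : NExp)
  | setReal (i : ℕ) (e : RExp)
  | put (a : ℕ) (i : NExp) (e : RExp)
  | svd (m n r a u s v : ℕ)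
  | seq (c d : Cmd)
  | branch (b : Cmp) (c d : Cmd)
  | loop (b : Cmp) (c : Cmd)

/-- Value of an address expression (subtraction is truncated, `half` rounds down). -/
def NExp.val (st : State) : NExp → ℕ
  | .const k => k
  | .reg i => st.nat i
  | .add e f => e.val st + f.val st
  | .sub e f => e.val st - f.val st
  | .half e => e.val st / 2

/-- Number of elementary operations in the evaluation of an address expression. -/
def NExp.cost : NExp → ℕ
  | .const _ => 1
  | .reg _ => 1
  | .add e f => e.cost + f.cost + 1
  | .sub e f => e.cost + f.cost + 1
  | .half e => e.cost + 1

/-- Value of a real expression (`x / 0 = 0`, and the root of a negative number is `0`). -/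
noncomputable def RExp.val (st : State) : RExp → ℝ
  | .const k => (k : ℝ)
  | .reg i => st.real i
  | .get a i => st.arr a (i.val st)
  | .add e f => e.val st + f.val st
  | .sub e f => e.val st - f.val st
  | .mul e f => e.val st * f.val st
  | .div e f => e.val st / f.val st
  | .sqrt e => Real.sqrt (e.val st)

/-- Number of elementary operations in the evaluation of a real expression. -/
def RExp.cost : RExp → ℕ
  | .const _ => 1
  | .reg _ => 1
  | .get _ i => i.cost + 1
  | .add e f => e.cost + f.cost + 1
  | .sub e f => e.cost + f.cost + 1
  | .mul e f => e.cost + f.cost + 1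
  | .div e f => e.cost + f.cost + 1
  | .sqrt e => e.cost + 1

/-- Outcome of a comparison. -/
def Cmp.holds (st : State) : Cmp → Prop
  | .natLT e f => e.val st < f.val st
  | .realLT e f => e.val st < f.val st

/-- Number of elementary operations in a comparison. -/
def Cmp.cost : Cmp → ℕ
  | .natLT e f => e.cost + f.cost + 1
  | .realLT e f => e.cost + f.cost + 1

/-- The program uses elementary operations only (no call of the SVD routine). -/
def Cmd.Elementary : Cmd → Prop
  | .skip => True
  | .setNat _ _ => True
  | .setReal _ _ => True
  | .put _ _ _ => True
  | .svd _ _ _ _ _ _ _ => False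
  | .seq c d => c.Elementary ∧ d.Elementary
  | .branch _ c d => c.Elementary ∧ d.Elementary
  | .loop _ c => c.Elementary

/-- Three factors of an `m × n` matrix, with `r` columns. -/
structure Factors (m n : ℕ) where
  r : ℕ
  U : Matrix (Fin m) (Fin r) ℝ
  σ : Fin r → ℝ
  V : Matrix (Fin n) (Fin r) ℝ

/-- The input-output behaviour of a factorization routine. -/
abbrev Routine := ∀ m n : ℕ, Matrix (Fin m) (Fin n) ℝ → Factors m n

/-- The routine returns an SVD of every matrix. -/
def Routine.Correct (O : Routine) : Prop :=
  ∀ (m n : ℕ) (Y : Matrix (Fin m) (Fin n) ℝ), IsSVD Y (O m n Y).U (O m n Y).σ (O m n Y).V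

/-- The array `f` holds the vector `v` in its first `p` cells. -/
def HoldsVec (f : ℕ → ℝ) {p : ℕ} (v : Fin p → ℝ) : Prop :=
  ∀ i : Fin p, f i = v i

/-- The array `f` holds the matrix `M` in its first `m * n` cells, row by row. -/
def HoldsMat (f : ℕ → ℝ) {m n : ℕ} (M : Matrix (Fin m) (Fin n) ℝ) : Prop :=
  ∀ (i : Fin m) (j : Fin n), f (i * n + j) = M i j

/-- The `m × n` matrix held by the array `f`. -/
def readMat (f : ℕ → ℝ) (m n : ℕ) : Matrix (Fin m) (Fin n) ℝ :=
  Matrix.of fun i j => f (i * n + j)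

/-- The array `f` after the vector `v` has been written to its first cells. -/
def writeVec (f : ℕ → ℝ) {p : ℕ} (v : Fin p → ℝ) : ℕ → ℝ :=
  fun t => if h : t < p then v ⟨t, h⟩ else f t

/-- The array `f` after the matrix `M` has been written to its first cells, row by row. -/
def writeMat (f : ℕ → ℝ) {m n : ℕ} (M : Matrix (Fin m) (Fin n) ℝ) : ℕ → ℝ :=
  writeVec f fun t : Fin (m * n) => M (finProdFinEquiv.symm t).1 (finProdFinEquiv.symm t).2

/-- Write a natural register. -/
def State.setNat (st : State) (i k : ℕ) : State :=
  { st with nat := Function.update st.nat i k }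

/-- Write a real register. -/
def State.setReal (st : State) (i : ℕ) (x : ℝ) : State :=
  { st with real := Function.update st.real i x }

/-- Replace an array. -/
def State.setArr (st : State) (a : ℕ) (f : ℕ → ℝ) : State :=
  { st with arr := Function.update st.arr a f }

/-- Write the factors `F` to the natural register `r` and to the arrays `u`, `s`, `v`. -/
def State.setFactors (st : State) {m n : ℕ} (F : Factors m n) (r u s v : ℕ) : State :=
  (((st.setNat r F.r).setArr u (writeMat (st.arr u) F.U)).setArr s
    (writeVec (st.arr s) F.σ)).setArr v (writeMat (st.arr v) F.V)

/-- `Exec O c st t st'`: with the routine `O`, the program `c` started in the state `st` halts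
after `t` steps in the state `st'`. A call of the routine on an `m × n` matrix is charged
`min(n²m, m²n)` steps, plus one. -/
inductive Exec (O : Routine) : Cmd → State → ℕ → State → Prop where
  | skip (st : State) : Exec O .skip st 1 st
  | setNat (st : State) (i : ℕ) (e : NExp) :
      Exec O (.setNat i e) st (e.cost + 1) (st.setNat i (e.val st))
  | setReal (st : State) (i : ℕ) (e : RExp) :
      Exec O (.setReal i e) st (e.cost + 1) (st.setReal i (e.val st))
  | put (st : State) (a : ℕ) (i : NExp) (e : RExp) :
      Exec O (.put a i e) st (i.cost + e.cost + 1)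
        (st.setArr a (Function.update (st.arr a) (i.val st) (e.val st)))
  | svd (st : State) (m n r a u s v : ℕ) :
      Exec O (.svd m n r a u s v) st
        (min (st.nat n ^ 2 * st.nat m) (st.nat m ^ 2 * st.nat n) + 1)
        (st.setFactors (O (st.nat m) (st.nat n) (readMat (st.arr a) (st.nat m) (st.nat n)))
          r u s v)
  | seq {c d : Cmd} {st st₁ st₂ : State} {t₁ t₂ : ℕ} :
      Exec O c st t₁ st₁ → Exec O d st₁ t₂ st₂ → Exec O (.seq c d) st (t₁ + t₂) st₂
  | branchTrue {b : Cmp} {c d : Cmd} {st st₁ : State} {t : ℕ} :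
      b.holds st → Exec O c st t st₁ → Exec O (.branch b c d) st (b.cost + t) st₁
  | branchFalse {b : Cmp} {c d : Cmd} {st st₁ : State} {t : ℕ} :
      ¬ b.holds st → Exec O d st t st₁ → Exec O (.branch b c d) st (b.cost + t) st₁
  | loopTrue {b : Cmp} {c : Cmd} {st st₁ st₂ : State} {t₁ t₂ : ℕ} :
      b.holds st → Exec O c st t₁ st₁ → Exec O (.loop b c) st₁ t₂ st₂ →
        Exec O (.loop b c) st (b.cost + t₁ + t₂) st₂
  | loopFalse {b : Cmp} {c : Cmd} {st : State} :
      ¬ b.holds st → Exec O (.loop b c) st b.cost st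

/-- The elementary program `P` solves the constrained vector shrinkage problem with norm `‖·‖_α`,
on every instance of dimension `p` within `T p` steps.
Input: `p` in natural register `0`, `δ` and `η` in real registers `0` and `1`, the vector in
array `0`; everything else in memory is arbitrary. Output: the optimal solution in array `1`. -/
def SolvesVec (α : ENNReal) (P : Cmd) (T : ℕ → ℕ) : Prop :=
  P.Elementary ∧
    ∀ (O : Routine) (p : ℕ) (q : Fin p → ℝ) (δ η : ℝ), 0 ≤ δ → 0 ≤ η →
      ∀ st : State, st.nat 0 = p → st.real 0 = δ → st.real 1 = η → HoldsVec (st.arr 0) q →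
        ∃ (t : ℕ) (st' : State) (s : Fin p → ℝ),
          Exec O P st t st' ∧ t ≤ T p ∧ HoldsVec (st'.arr 1) s ∧ IsVecSol α δ η q s

/-- With every correct SVD routine, the program `Q` solves the constrained matrix shrinkage
problem with norm `‖σ(·)‖_α`, on every instance `Y` of size `m × n`, `m, n ≥ 1`, within `B m n r`
steps, where `r` is the number of columns of the SVD of `Y` that the routine computes.
Input: `m`, `n` in natural registers `0` and `1`, `δ` and `η` in real registers `0` and `1`, the
matrix `Y` in array `0`; everything else in memory is arbitrary.
Output: the optimal solution in array `1`. -/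
def SolvesMat (α : ENNReal) (Q : Cmd) (B : ℕ → ℕ → ℕ → ℕ) : Prop :=
  ∀ O : Routine, O.Correct →
    ∀ (m n : ℕ) (Y : Matrix (Fin m) (Fin n) ℝ) (δ η : ℝ), 1 ≤ m → 1 ≤ n → 0 ≤ δ → 0 ≤ η →
      ∀ st : State, st.nat 0 = m → st.nat 1 = n → st.real 0 = δ → st.real 1 = η →
        HoldsMat (st.arr 0) Y →
        ∃ (t : ℕ) (st' : State) (X : Matrix (Fin m) (Fin n) ℝ),
          Exec O Q st t st' ∧ t ≤ B m n (O m n Y).r ∧ HoldsMat (st'.arr 1) X ∧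
            IsMatSol α δ η Y X

end RealRAM

/-! For the reduction to vectors, fix the SVD of `Y` and let `d` be the diagonal of `Uᵀ X V`. Two
facts carry it. Passing to `d` does not increase the norm: writing `X = A diag(τ) Bᵀ`, the map from
`τ` to `d` is dominated entrywise by a doubly substochastic matrix (`ellNorm_diagCoeff_le`), and
such matrices contract the `ℓ_1`, `ℓ_2` and `ℓ_∞` norms. And `U diag(d) Vᵀ` is the Frobenius
projection of `X` onto the matrices `U diag(t) Vᵀ`, so Pythagoras splits `‖X - Y‖_F²` into a
remainder plus `‖d - σ‖²` (`frobSq_sub`). Hence every feasible `X` costs at least as much as the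
feasible vector `d`, with equality only if the remainder vanishes. Compactness gives a vector
solution, strict convexity makes it unique, and both properties pass to the matrix problem.

The vector problem is solved through a duality certificate (`isVecSol_of_dual`). For `ℓ_2` the
solution is a multiple of `q`. For `ℓ_1` it is a soft thresholding and for `ℓ_∞` a clipping; both
need a level above which `|q|` has a prescribed total excess, `η` in the first case and `δ` in the
second. Extracting maxima greedily from a tournament tree finds this level with `p` extractions of
logarithmic cost.

Programs are verified with a Hoare logic that carries time bounds (`Runs`), together with the
syntactic fact that memory outside a program's write set is preserved (`Exec.frame`). The matrix
program calls the SVD routine, runs the vector program on the singular values and multiplies the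
factors. Orthonormality forces `r ≤ min m n`, so the multiplication costs no more than the SVD up to
a constant. -/

theorem ellNorm_one {p : ℕ} (s : Fin p → ℝ) : ellNorm 1 s = ∑ i, |s i| := by
  simp [ellNorm, PiLp.norm_eq_of_L1]

theorem ellNorm_two {p : ℕ} (s : Fin p → ℝ) : ellNorm 2 s = Real.sqrt (∑ i, s i ^ 2) := by
  simp [ellNorm, PiLp.norm_eq_of_L2]

theorem ellNorm_top {p : ℕ} (s : Fin p → ℝ) : ellNorm ⊤ s = ‖s‖ := by
  simp [ellNorm]

theorem ellNorm_nonneg {α : ENNReal} (hα : 1 ≤ α) {p : ℕ} (s : Fin p → ℝ) : 0 ≤ ellNorm α s := by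
  have : Fact (1 ≤ α) := ⟨hα⟩
  exact norm_nonneg _

theorem one_le_of_cases {α : ENNReal} (hα : α = 1 ∨ α = 2 ∨ α = ⊤) : 1 ≤ α := by
  rcases hα with rfl | rfl | rfl <;> simp

/-! ### Contraction of the norms under passage to the diagonal -/

/-- A doubly substochastic matrix does not increase the `ℓ_α` norm. -/
theorem ellNorm_le_of_substochastic {α : ENNReal} (hα : α = 1 ∨ α = 2 ∨ α = ⊤) {r k : ℕ}
    (D : Fin r → Fin k → ℝ) (s : Fin r → ℝ) (τ : Fin k → ℝ) (hD : ∀ i j, 0 ≤ D i j)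
    (hrow : ∀ i, ∑ j, D i j ≤ 1) (hcol : ∀ j, ∑ i, D i j ≤ 1)
    (hs : ∀ i, |s i| ≤ ∑ j, D i j * |τ j|) : ellNorm α s ≤ ellNorm α τ := by
  rcases hα with rfl | rfl | rfl
  · rw [ellNorm_one, ellNorm_one]
    calc ∑ i, |s i| ≤ ∑ i, ∑ j, D i j * |τ j| := Finset.sum_le_sum fun i _ => hs i
      _ = ∑ j, (∑ i, D i j) * |τ j| := by
          rw [Finset.sum_comm]; simp_rw [Finset.sum_mul]
      _ ≤ ∑ j, |τ j| := Finset.sum_le_sum fun j _ =>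
          mul_le_of_le_one_left (abs_nonneg _) (hcol j)
  · rw [ellNorm_two, ellNorm_two]
    apply Real.sqrt_le_sqrt
    have key : ∀ i, s i ^ 2 ≤ ∑ j, D i j * τ j ^ 2 := by
      intro i
      -- Cauchy–Schwarz with weights `D i j`. The row sums are used here, the column sums when
      -- adding over `i`.
      have h1 : (∑ j, D i j * |τ j|) ^ 2 ≤ (∑ j, D i j) * ∑ j, D i j * τ j ^ 2 := by
        apply Finset.sum_sq_le_sum_mul_sum_of_sq_le_mul
        · intro j _; exact hD i j
        · intro j _; exact mul_nonneg (hD i j) (sq_nonneg _)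
        · intro j _; rw [mul_pow, sq_abs]; exact le_of_eq (by ring)
      have h0 : 0 ≤ ∑ j, D i j * τ j ^ 2 :=
        Finset.sum_nonneg fun j _ => mul_nonneg (hD i j) (sq_nonneg _)
      calc s i ^ 2 = |s i| ^ 2 := (sq_abs _).symm
        _ ≤ (∑ j, D i j * |τ j|) ^ 2 := pow_le_pow_left₀ (abs_nonneg _) (hs i) 2
        _ ≤ _ := h1
        _ ≤ _ := mul_le_of_le_one_left h0 (hrow i)
    calc ∑ i, s i ^ 2 ≤ ∑ i, ∑ j, D i j * τ j ^ 2 := Finset.sum_le_sum fun i _ => key i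
      _ = ∑ j, (∑ i, D i j) * τ j ^ 2 := by
          rw [Finset.sum_comm]; simp_rw [Finset.sum_mul]
      _ ≤ ∑ j, τ j ^ 2 := Finset.sum_le_sum fun j _ =>
          mul_le_of_le_one_left (sq_nonneg _) (hcol j)
  · rw [ellNorm_top, ellNorm_top, pi_norm_le_iff_of_nonneg (norm_nonneg _)]
    intro i
    calc ‖s i‖ ≤ ∑ j, D i j * |τ j| := hs i
      _ ≤ ∑ j, D i j * ‖τ‖ := Finset.sum_le_sum fun j _ =>
          mul_le_mul_of_nonneg_left (norm_le_pi_norm τ j) (hD i j)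
      _ = (∑ j, D i j) * ‖τ‖ := by rw [Finset.sum_mul]
      _ ≤ ‖τ‖ := mul_le_of_le_one_left (norm_nonneg _) (hrow i)

/-- Bessel's inequality for a matrix whose columns are orthogonal and of norm at most one. -/
theorem bessel_mulVec {m k : ℕ} (A : Matrix (Fin m) (Fin k) ℝ) (e : Fin k → ℝ)
    (hA : A.transpose * A = Matrix.diagonal e) (he : ∀ j, e j ≤ 1) (x : Fin m → ℝ) :
    ∑ j, (A.transpose.mulVec x) j ^ 2 ≤ ∑ i, x i ^ 2 := by
  set y := A.transpose.mulVec x with hy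
  -- The squared length of `x - A y` with `y = Aᵀ x` equals `|x|² - 2|y|² + ∑ e_j y_j²`, which is at
  -- most `|x|² - |y|²`.
  have h0 : 0 ≤ dotProduct (x - A.mulVec y) (x - A.mulVec y) :=
    Finset.sum_nonneg fun i _ => mul_self_nonneg _
  have h1 : dotProduct x (A.mulVec y) = dotProduct y y := by
    rw [Matrix.dotProduct_mulVec, ← Matrix.mulVec_transpose]
  have h2 : dotProduct (A.mulVec y) (A.mulVec y) = ∑ j, e j * y j ^ 2 := by
    rw [Matrix.dotProduct_mulVec, ← Matrix.mulVec_transpose, Matrix.mulVec_mulVec, hA]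
    simp [dotProduct, Matrix.mulVec_diagonal]
    exact Finset.sum_congr rfl fun j _ => by ring
  have h3 : ∑ j, e j * y j ^ 2 ≤ ∑ j, y j ^ 2 :=
    Finset.sum_le_sum fun j _ => mul_le_of_le_one_left (sq_nonneg _) (he j)
  have h4 : dotProduct y y = ∑ j, y j ^ 2 := by simp [dotProduct, sq]
  have h5 : dotProduct x x = ∑ j, x j ^ 2 := by simp [dotProduct, sq]
  rw [sub_dotProduct, dotProduct_sub, dotProduct_sub, dotProduct_comm (A.mulVec y) x, h1, h2] at h0
  linarith

/-- The diagonal of `Uᵀ X V`. -/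
def diagCoeff {m n r : ℕ} (U : Matrix (Fin m) (Fin r) ℝ) (V : Matrix (Fin n) (Fin r) ℝ)
    (X : Matrix (Fin m) (Fin n) ℝ) : Fin r → ℝ := fun i => (U.transpose * X * V) i i

theorem sum_sq_col {m k : ℕ} (A : Matrix (Fin m) (Fin k) ℝ) (e : Fin k → ℝ)
    (hA : A.transpose * A = Matrix.diagonal e) (j : Fin k) : ∑ i, A i j ^ 2 = e j := by
  have := congrFun (congrFun hA j) j
  simp only [Matrix.mul_apply, Matrix.transpose_apply, Matrix.diagonal_apply_eq] at this
  rw [← this]; exact Finset.sum_congr rfl fun j _ => by ring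

/-- Row `i` of `Uᵀ A` is `Aᵀ` applied to column `i` of `U`, so Bessel's inequality bounds it by the
squared length `f i` of that column. -/
theorem sum_sq_row_transpose_mul {m r k : ℕ} (U : Matrix (Fin m) (Fin r) ℝ)
    (A : Matrix (Fin m) (Fin k) ℝ) (e : Fin k → ℝ) (f : Fin r → ℝ)
    (hA : A.transpose * A = Matrix.diagonal e) (he : ∀ j, e j ≤ 1)
    (hU : U.transpose * U = Matrix.diagonal f) (hf : ∀ j, f j ≤ 1) (i : Fin r) :
    ∑ j, (U.transpose * A) i j ^ 2 ≤ 1 := by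
  refine le_trans ?_ ((bessel_mulVec A e hA he fun l => U l i).trans
    ((sum_sq_col U f hU i).trans_le (hf i)))
  refine (Finset.sum_congr rfl fun j _ => ?_).le
  simp only [Matrix.mul_apply, Matrix.mulVec, dotProduct, Matrix.transpose_apply]
  simp_rw [mul_comm]

theorem sum_sq_col_transpose_mul {m r k : ℕ} (U : Matrix (Fin m) (Fin r) ℝ)
    (A : Matrix (Fin m) (Fin k) ℝ) (e : Fin k → ℝ) (f : Fin r → ℝ)
    (hA : A.transpose * A = Matrix.diagonal e) (he : ∀ j, e j ≤ 1)
    (hU : U.transpose * U = Matrix.diagonal f) (hf : ∀ j, f j ≤ 1) (j : Fin k) :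
    ∑ i, (U.transpose * A) i j ^ 2 ≤ 1 := by
  refine le_trans (Finset.sum_congr rfl fun i _ => ?_).le
    (sum_sq_row_transpose_mul A U f e hU hf hA he j)
  rw [← Matrix.transpose_apply (U.transpose * A), Matrix.transpose_mul, Matrix.transpose_transpose]

/-- If `X = A diag(τ) Bᵀ`, the diagonal of `Uᵀ X V` has at most the `ℓ_α` norm of `τ`. -/
theorem ellNorm_diagCoeff_le {α : ENNReal} (hα : α = 1 ∨ α = 2 ∨ α = ⊤) {m n r k : ℕ}
    (U : Matrix (Fin m) (Fin r) ℝ) (V : Matrix (Fin n) (Fin r) ℝ)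
    (A : Matrix (Fin m) (Fin k) ℝ) (B : Matrix (Fin n) (Fin k) ℝ) (τ : Fin k → ℝ)
    {eU eV : Fin r → ℝ} {eA eB : Fin k → ℝ}
    (hU : U.transpose * U = Matrix.diagonal eU) (hU1 : ∀ i, eU i ≤ 1)
    (hV : V.transpose * V = Matrix.diagonal eV) (hV1 : ∀ i, eV i ≤ 1)
    (hA : A.transpose * A = Matrix.diagonal eA) (hA1 : ∀ i, eA i ≤ 1)
    (hB : B.transpose * B = Matrix.diagonal eB) (hB1 : ∀ i, eB i ≤ 1) :
    ellNorm α (diagCoeff U V (A * Matrix.diagonal τ * B.transpose)) ≤ ellNorm α τ := by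
  set W := U.transpose * A
  set Z := V.transpose * B
  -- The coefficient of `τ j` is `W i j * Z i j`, bounded in absolute value by the mean of the two
  -- squares. Bessel bounds the row and column sums of each square by one, hence also those of the
  -- mean.
  refine ellNorm_le_of_substochastic hα (fun i j => (W i j ^ 2 + Z i j ^ 2) / 2) _ τ ?_ ?_ ?_ ?_
  · intro i j; positivity
  · intro i
    have h1 := sum_sq_row_transpose_mul U A eA eU hA hA1 hU hU1 i
    have h2 := sum_sq_row_transpose_mul V B eB eV hB hB1 hV hV1 i
    rw [← Finset.sum_div, Finset.sum_add_distrib]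
    linarith
  · intro j
    have h1 := sum_sq_col_transpose_mul U A eA eU hA hA1 hU hU1 j
    have h2 := sum_sq_col_transpose_mul V B eB eV hB hB1 hV hV1 j
    rw [← Finset.sum_div, Finset.sum_add_distrib]
    linarith
  · intro i
    have h : diagCoeff U V (A * Matrix.diagonal τ * B.transpose) i = ∑ j, W i j * Z i j * τ j := by
      have : U.transpose * (A * Matrix.diagonal τ * B.transpose) * V
          = W * Matrix.diagonal τ * Z.transpose := by
        simp [W, Z, Matrix.mul_assoc]
      simp only [diagCoeff, this]
      rw [Matrix.mul_apply]
      simp only [Matrix.mul_diagonal, Matrix.transpose_apply]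
      exact Finset.sum_congr rfl fun j _ => by ring
    rw [h]
    refine (Finset.abs_sum_le_sum_abs _ _).trans (Finset.sum_le_sum fun j _ => ?_)
    rw [abs_mul]
    refine mul_le_mul_of_nonneg_right ?_ (abs_nonneg _)
    rw [abs_mul]
    nlinarith [sq_nonneg (|W i j| - |Z i j|), sq_abs (W i j), sq_abs (Z i j)]

/-! ### Singular value decomposition -/

/-- Existence of a singular value decomposition; columns of `A` that belong to the singular value
zero may be zero. -/
theorem exists_svd {m n : ℕ} (X : Matrix (Fin m) (Fin n) ℝ) :
    ∃ (A : Matrix (Fin m) (Fin (min m n)) ℝ) (B : Matrix (Fin n) (Fin (min m n)) ℝ)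
      (e : Fin (min m n) → ℝ), A.transpose * A = Matrix.diagonal e ∧ (∀ j, e j ≤ 1) ∧
        B.transpose * B = 1 ∧ (∀ j, e j * singVals X j = singVals X j) ∧
        X = A * Matrix.diagonal (singVals X) * B.transpose := by
  set T := Matrix.toEuclideanLin X with hT
  have hn : Module.finrank ℝ (EuclideanSpace ℝ (Fin n)) = n := finrank_euclideanSpace_fin
  set v := T.isSymmetric_adjoint_comp_self.eigenvectorBasis hn with hv
  set σ : ℕ → ℝ := fun i => T.singularValues i with hσ
  let ι : Fin (min m n) → Fin n := Fin.castLE (min_le_right _ _)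
  have hι : Function.Injective ι := Fin.castLE_injective _
  -- Moving `T` to the other side leaves the eigenvector equation of `T* T`, whose eigenvalues are
  -- the squared singular values.
  have hinner : ∀ a b, inner ℝ (T (v a)) (T (v b)) = if a = b then σ a ^ 2 else 0 := by
    intro a b
    rw [← LinearMap.adjoint_inner_right]
    have := T.isSymmetric_adjoint_comp_self.apply_eigenvectorBasis hn b
    rw [LinearMap.comp_apply] at this
    rw [this, inner_smul_right, ← hv, orthonormal_iff_ite.mp v.orthonormal a b, hσ]
    simp only [T.sq_singularValues_fin hn a]
    split_ifs with h
    · subst h; simp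
    · simp
  have hzero : ∀ a : Fin n, σ a = 0 → T (v a) = 0 := by
    intro a h
    have := hinner a a
    simp only [if_true, h] at this
    simpa using this
  let Bn : Matrix (Fin n) (Fin n) ℝ := Matrix.of fun i j => v j i
  have hBn : Bn.transpose * Bn = 1 := by
    ext a b
    have := orthonormal_iff_ite.mp v.orthonormal a b
    rw [PiLp.inner_apply] at this
    simp only [Matrix.mul_apply, Matrix.transpose_apply, Bn, Matrix.of_apply, Matrix.one_apply]
    rw [← this]
    exact Finset.sum_congr rfl fun i _ => by simp [mul_comm]
  have hXB : ∀ i j, (X * Bn) i j = T (v j) i := by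
    intro i j
    simp [hT, Matrix.mul_apply, Matrix.mulVec, dotProduct, Bn]
  -- Since `0⁻¹ = 0`, columns with zero singular value vanish. The Gram matrix is then a diagonal of
  -- zeros and ones, and no completion to an orthonormal family is needed.
  let A : Matrix (Fin m) (Fin (min m n)) ℝ := Matrix.of fun i j => (σ j)⁻¹ * T (v (ι j)) i
  let B : Matrix (Fin n) (Fin (min m n)) ℝ := Matrix.of fun i j => v (ι j) i
  have hιv : ∀ j, ((ι j : Fin n) : ℕ) = j := fun j => rfl
  -- The rank is at most `m` and at most `n`, so cutting the eigenbasis down to its first `min m n`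
  -- vectors loses nothing.
  have hrank : ∀ j : ℕ, min m n ≤ j → σ j = 0 := by
    intro j hj
    simp only [hσ]
    rw [LinearMap.singularValues_eq_zero_iff_le_finrank_range]
    refine le_trans ?_ hj
    refine le_min ?_ ?_
    · simpa using Submodule.finrank_le (LinearMap.range T)
    · simpa using LinearMap.finrank_range_le T
  refine ⟨A, B, fun j => if σ j = 0 then 0 else 1, ?_, ?_, ?_, ?_, ?_⟩
  · ext a b
    have h1 := hinner (ι a) (ι b)
    rw [PiLp.inner_apply] at h1
    have h2 : (A.transpose * A) a b = (σ a)⁻¹ * (σ b)⁻¹ *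
        ∑ i, inner ℝ (T (v (ι a)) i) (T (v (ι b)) i) := by
      simp only [Matrix.mul_apply, Matrix.transpose_apply, A, Matrix.of_apply, Finset.mul_sum]
      exact Finset.sum_congr rfl fun i _ => by simp; ring
    rw [h2, h1, Matrix.diagonal_apply]
    by_cases hab : a = b
    · subst hab
      simp only [if_true, hιv]
      split_ifs with h
      · simp [h]
      · field_simp
    · simp [hab, hι.ne hab]
  · intro j; simp only; split_ifs <;> norm_num
  · ext a b
    have := congrFun (congrFun hBn (ι a)) (ι b)
    simp only [Matrix.mul_apply, Matrix.transpose_apply, Bn, B, Matrix.of_apply,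
      Matrix.one_apply, hι.eq_iff] at this ⊢
    exact this
  · intro j
    change (if σ j = 0 then (0:ℝ) else 1) * σ j = σ j
    split_ifs with h <;> simp [h]
  · have hX : X = (X * Bn) * Bn.transpose := by
      rw [Matrix.mul_assoc, mul_eq_one_comm.mp hBn, Matrix.mul_one]
    ext i l
    conv_lhs => rw [hX]
    rw [Matrix.mul_apply, Matrix.mul_apply]
    symm
    refine Fintype.sum_of_injective ι hι _ _ ?_ ?_
    · intro j hj
      have : min m n ≤ j := by
        by_contra! h
        exact hj ⟨⟨j, h⟩, rfl⟩
      rw [hXB, hzero j (hrank j this)]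
      simp
    · intro j
      rw [hXB, Matrix.mul_diagonal]
      simp only [A, B, Bn, Matrix.of_apply, Matrix.transpose_apply]
      change _ * _ * σ j * _ = _
      by_cases h : σ j = 0
      · rw [hzero (ι j) h]; simp
      · field_simp

/-- The condition `e j * s j = s j` admits the factors of `exists_svd`, where columns of `U` may
vanish wherever `s` does. -/
theorem diagCoeff_self {m n r : ℕ} (U : Matrix (Fin m) (Fin r) ℝ) (V : Matrix (Fin n) (Fin r) ℝ)
    (s e : Fin r → ℝ) (hU : U.transpose * U = Matrix.diagonal e) (hV : V.transpose * V = 1)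
    (hs : ∀ j, e j * s j = s j) :
    diagCoeff U V (U * Matrix.diagonal s * V.transpose) = s := by
  have : U.transpose * (U * Matrix.diagonal s * V.transpose) * V
      = (U.transpose * U) * Matrix.diagonal s * (V.transpose * V) := by
    simp [Matrix.mul_assoc]
  funext i
  rw [diagCoeff, this, hU, hV, Matrix.mul_one, Matrix.diagonal_mul_diagonal,
    Matrix.diagonal_apply_eq, hs]

theorem one_eq_diagonal (r : ℕ) :
    (1 : Matrix (Fin r) (Fin r) ℝ) = Matrix.diagonal fun _ => 1 := Matrix.diagonal_one.symm

theorem ellNorm_diagCoeff_le_singVals {α : ENNReal} (hα : α = 1 ∨ α = 2 ∨ α = ⊤) {m n r : ℕ}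
    (U : Matrix (Fin m) (Fin r) ℝ) (V : Matrix (Fin n) (Fin r) ℝ)
    (hU : U.transpose * U = 1) (hV : V.transpose * V = 1) (X : Matrix (Fin m) (Fin n) ℝ) :
    ellNorm α (diagCoeff U V X) ≤ ellNorm α (singVals X) := by
  obtain ⟨A, B, e, hA, he, hB, hs, hX⟩ := exists_svd X
  rw [one_eq_diagonal] at hU hV hB
  conv_lhs => rw [hX]
  exact ellNorm_diagCoeff_le hα U V A B _ hU (fun _ => le_rfl) hV (fun _ => le_rfl) hA he hB
    (fun _ => le_rfl)

/-- With respect to the factors of either decomposition, the diagonal of the matrix is the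
corresponding vector, `s` or the singular values. The contraction applied in both directions gives
equality, without comparing the two vectors up to order and sign. -/
theorem ellNorm_singVals_eq {α : ENNReal} (hα : α = 1 ∨ α = 2 ∨ α = ⊤) {m n r : ℕ}
    (U : Matrix (Fin m) (Fin r) ℝ) (V : Matrix (Fin n) (Fin r) ℝ)
    (hU : U.transpose * U = 1) (hV : V.transpose * V = 1) (s : Fin r → ℝ) :
    ellNorm α (singVals (U * Matrix.diagonal s * V.transpose)) = ellNorm α s := by
  set X := U * Matrix.diagonal s * V.transpose with hXdef
  apply le_antisymm
  · obtain ⟨A, B, e, hA, he, hB, hs, hX⟩ := exists_svd X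
    have h1 := diagCoeff_self A B (singVals X) e hA hB hs
    rw [← hX] at h1
    conv_lhs => rw [← h1]
    rw [one_eq_diagonal] at hU hV hB
    exact ellNorm_diagCoeff_le hα A B U V _ hA he hB (fun _ => le_rfl) hU (fun _ => le_rfl) hV
      (fun _ => le_rfl)
  · have h1 := diagCoeff_self U V s (fun _ => 1) (by rw [hU, one_eq_diagonal]) hV (by simp)
    conv_lhs => rw [← h1]
    exact ellNorm_diagCoeff_le_singVals hα U V hU hV X

/-! ### Reduction of the matrix problem to the vector problem -/

/-- The squared Frobenius norm. -/
noncomputable def frobSq {m n : ℕ} (X : Matrix (Fin m) (Fin n) ℝ) : ℝ := ∑ i, ∑ j, X i j ^ 2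

theorem frobSq_eq_trace {m n : ℕ} (X : Matrix (Fin m) (Fin n) ℝ) :
    frobSq X = (X.transpose * X).trace := by
  simp only [frobSq, Matrix.trace, Matrix.diag, Matrix.mul_apply, Matrix.transpose_apply]
  rw [Finset.sum_comm]
  simp_rw [sq]

theorem frobSq_nonneg {m n : ℕ} (X : Matrix (Fin m) (Fin n) ℝ) : 0 ≤ frobSq X :=
  Finset.sum_nonneg fun _ _ => Finset.sum_nonneg fun _ _ => sq_nonneg _

theorem eq_zero_of_frobSq_eq_zero {m n : ℕ} {X : Matrix (Fin m) (Fin n) ℝ} (h : frobSq X = 0) :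
    X = 0 := by
  ext i j
  have h1 := (Finset.sum_eq_zero_iff_of_nonneg
    (fun _ _ => Finset.sum_nonneg fun _ _ => sq_nonneg _)).mp h i (Finset.mem_univ _)
  have h2 := (Finset.sum_eq_zero_iff_of_nonneg (fun _ _ => sq_nonneg _)).mp h1 j
    (Finset.mem_univ _)
  simpa using h2

/-- Pythagoras: the matrices `U diag(t) Vᵀ` form an isometric copy of `ℝ^r`, onto which `X` projects
with coefficients `diagCoeff U V X`. The expansion `key` is used for `t = σ` and for these
coefficients. -/
theorem frobSq_sub {m n r : ℕ} (U : Matrix (Fin m) (Fin r) ℝ) (V : Matrix (Fin n) (Fin r) ℝ)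
    (hU : U.transpose * U = 1) (hV : V.transpose * V = 1) (X : Matrix (Fin m) (Fin n) ℝ)
    (σ : Fin r → ℝ) :
    frobSq (X - U * Matrix.diagonal σ * V.transpose) =
      frobSq (X - U * Matrix.diagonal (diagCoeff U V X) * V.transpose) +
        ∑ i, (diagCoeff U V X i - σ i) ^ 2 := by
  have key : ∀ t : Fin r → ℝ, frobSq (X - U * Matrix.diagonal t * V.transpose) =
      frobSq X - 2 * ∑ i, t i * diagCoeff U V X i + ∑ i, t i ^ 2 := by
    intro t
    set Y := U * Matrix.diagonal t * V.transpose with hY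
    have h1 : (Y.transpose * X).trace = ∑ i, t i * diagCoeff U V X i := by
      have : Y.transpose * X = V * (Matrix.diagonal t * (U.transpose * X)) := by
        simp [hY, Matrix.mul_assoc]
      rw [this, Matrix.trace_mul_comm, Matrix.mul_assoc]
      simp [Matrix.trace, Matrix.diagonal_mul, diagCoeff]
    have h2 : (X.transpose * Y).trace = ∑ i, t i * diagCoeff U V X i := by
      rw [← h1, ← Matrix.trace_transpose, Matrix.transpose_mul, Matrix.transpose_transpose]
    have h3 : (Y.transpose * Y).trace = ∑ i, t i ^ 2 := by
      have : Y.transpose * Y = V * (Matrix.diagonal t * (U.transpose * U) * Matrix.diagonal t *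
          V.transpose) := by
        simp [hY, Matrix.mul_assoc]
      rw [this, Matrix.trace_mul_comm, Matrix.mul_assoc, hU, hV]
      simp [Matrix.trace, sq]
    rw [frobSq_eq_trace, frobSq_eq_trace, Matrix.transpose_sub, Matrix.sub_mul, Matrix.mul_sub,
      Matrix.mul_sub]
    simp only [Matrix.trace_sub, h1, h2, h3]
    ring
  rw [key, key]
  have : ∀ a b : Fin r → ℝ, ∑ i, (a i - b i) ^ 2 =
      ∑ i, a i ^ 2 - 2 * ∑ i, b i * a i + ∑ i, b i ^ 2 := by
    intro a b
    rw [Finset.mul_sum, ← Finset.sum_sub_distrib, ← Finset.sum_add_distrib]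
    exact Finset.sum_congr rfl fun i _ => by ring
  rw [this]
  have : ∑ i, diagCoeff U V X i * diagCoeff U V X i = ∑ i, diagCoeff U V X i ^ 2 := by
    simp_rw [sq]
  rw [this]
  ring

theorem matObj_eq {α : ENNReal} (δ : ℝ) {m n : ℕ} (Y X : Matrix (Fin m) (Fin n) ℝ) :
    matObj α δ Y X = δ * ellNorm α (singVals X) + 1 / 2 * frobSq (X - Y) := by
  simp [matObj, frobSq]

theorem matObj_diagonal {α : ENNReal} (hα : α = 1 ∨ α = 2 ∨ α = ⊤) {m n r : ℕ} (δ : ℝ)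
    {Y : Matrix (Fin m) (Fin n) ℝ} {U : Matrix (Fin m) (Fin r) ℝ} {σ : Fin r → ℝ}
    {V : Matrix (Fin n) (Fin r) ℝ} (h : IsSVD Y U σ V) (s : Fin r → ℝ) :
    matObj α δ Y (U * Matrix.diagonal s * V.transpose) = vecObj α δ σ s := by
  rw [matObj_eq, h.eq, frobSq_sub U V h.left_orthonormal h.right_orthonormal,
    diagCoeff_self U V s (fun _ => 1) (by rw [h.left_orthonormal, one_eq_diagonal])
      h.right_orthonormal (by simp), sub_self,
    ellNorm_singVals_eq hα U V h.left_orthonormal h.right_orthonormal, vecObj]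
  simp [frobSq]

/-- `U diag(s) Vᵀ` beats every other feasible matrix if `s` solves the vector problem. -/
theorem matObj_ge {α : ENNReal} (hα : α = 1 ∨ α = 2 ∨ α = ⊤) {m n r : ℕ} {δ η : ℝ} (hδ : 0 ≤ δ)
    {Y : Matrix (Fin m) (Fin n) ℝ} {U : Matrix (Fin m) (Fin r) ℝ} {σ : Fin r → ℝ}
    {V : Matrix (Fin n) (Fin r) ℝ} (h : IsSVD Y U σ V) {X : Matrix (Fin m) (Fin n) ℝ}
    (hX : ellNorm α (singVals X) ≤ η) :
    ellNorm α (diagCoeff U V X) ≤ η ∧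
    vecObj α δ σ (diagCoeff U V X) +
      1 / 2 * frobSq (X - U * Matrix.diagonal (diagCoeff U V X) * V.transpose) ≤
        matObj α δ Y X := by
  have h1 := ellNorm_diagCoeff_le_singVals hα U V h.left_orthonormal h.right_orthonormal X
  refine ⟨h1.trans hX, ?_⟩
  rw [matObj_eq, h.eq, frobSq_sub U V h.left_orthonormal h.right_orthonormal X σ, vecObj]
  nlinarith [mul_le_mul_of_nonneg_left h1 hδ]

theorem isMatSol_of_isVecSol {α : ENNReal} (hα : α = 1 ∨ α = 2 ∨ α = ⊤) {m n r : ℕ} {δ η : ℝ}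
    (hδ : 0 ≤ δ) {Y : Matrix (Fin m) (Fin n) ℝ} {U : Matrix (Fin m) (Fin r) ℝ} {σ : Fin r → ℝ}
    {V : Matrix (Fin n) (Fin r) ℝ} (h : IsSVD Y U σ V) {s : Fin r → ℝ}
    (hs : IsVecSol α δ η σ s) : IsMatSol α δ η Y (U * Matrix.diagonal s * V.transpose) := by
  refine ⟨by rw [ellNorm_singVals_eq hα U V h.left_orthonormal h.right_orthonormal]; exact hs.1,
    fun X' hX' => ?_⟩
  obtain ⟨h1, h2⟩ := matObj_ge hα hδ h hX'
  rw [matObj_diagonal hα δ h]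
  have := hs.2 _ h1
  have := frobSq_nonneg (X' - U * Matrix.diagonal (diagCoeff U V X') * V.transpose)
  linarith

/-- Strict convexity at the midpoint `w`: the norm is convex, while the parallelogram identity makes
the quadratic term smaller than the average by `1/8 ∑ (s i - t i)²`. -/
theorem IsVecSol.unique {α : ENNReal} (hα : 1 ≤ α) {δ η : ℝ} (hδ : 0 ≤ δ) {p : ℕ}
    {q s t : Fin p → ℝ} (hs : IsVecSol α δ η q s) (ht : IsVecSol α δ η q t) : s = t := by
  have : Fact (1 ≤ α) := ⟨hα⟩
  let w : Fin p → ℝ := fun i => (s i + t i) / 2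
  have hw : ellNorm α w ≤ (ellNorm α s + ellNorm α t) / 2 := by
    have : (WithLp.toLp α w : PiLp α fun _ : Fin p => ℝ) =
        (1 / 2 : ℝ) • (WithLp.toLp α s + WithLp.toLp α t) := by
      ext i; simp [w]; ring
    simp only [ellNorm]
    rw [this, norm_smul]
    have := norm_add_le (WithLp.toLp α s : PiLp α fun _ : Fin p => ℝ) (WithLp.toLp α t)
    norm_num
    linarith
  have h1 := hs.2 w (by linarith [hs.1, ht.1])
  have h2 := ht.2 w (by linarith [hs.1, ht.1])
  have h3 : ∑ i, (w i - q i) ^ 2 = 1 / 2 * ∑ i, (s i - q i) ^ 2 + 1 / 2 * ∑ i, (t i - q i) ^ 2 -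
      1 / 4 * ∑ i, (s i - t i) ^ 2 := by
    rw [Finset.mul_sum, Finset.mul_sum, Finset.mul_sum, ← Finset.sum_add_distrib,
      ← Finset.sum_sub_distrib]
    exact Finset.sum_congr rfl fun i _ => by simp only [w]; ring
  have h4 := mul_le_mul_of_nonneg_left hw hδ
  simp only [vecObj] at h1 h2
  have h5 : ∑ i, (s i - t i) ^ 2 ≤ 0 := by nlinarith
  have h6 : ∑ i, (s i - t i) ^ 2 = 0 := le_antisymm h5 (Finset.sum_nonneg fun _ _ => sq_nonneg _)
  rw [Finset.sum_eq_zero_iff_of_nonneg (fun _ _ => sq_nonneg _)] at h6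
  funext i
  have := h6 i (Finset.mem_univ _)
  exact sub_eq_zero.mp (pow_eq_zero_iff (two_ne_zero) |>.mp this)

theorem exists_isVecSol {α : ENNReal} (hα : 1 ≤ α) (δ : ℝ) {η : ℝ} (hη : 0 ≤ η) {p : ℕ}
    (q : Fin p → ℝ) : ∃ s, IsVecSol α δ η q s := by
  have : Fact (1 ≤ α) := ⟨hα⟩
  have hc : IsCompact (Metric.closedBall (0 : PiLp α fun _ : Fin p => ℝ) η) :=
    isCompact_closedBall _ _
  obtain ⟨x, hx, hmin⟩ := hc.exists_isMinOn ⟨0, by simpa using hη⟩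
    (f := fun x => δ * ‖x‖ + 1 / 2 * ∑ i, (x i - q i) ^ 2) (by fun_prop)
  refine ⟨x.ofLp, by simpa [ellNorm] using hx, fun s' hs' => ?_⟩
  exact hmin (a := WithLp.toLp α s') (by simpa [ellNorm] using hs')

/-- Optimality of `X` forces equality in `matObj_ge`. Thus its diagonal solves the vector problem,
hence equals `s`, and the Frobenius remainder is zero. -/
theorem IsMatSol.eq_diagonal {α : ENNReal} (hα : α = 1 ∨ α = 2 ∨ α = ⊤) {m n r : ℕ} {δ η : ℝ}
    (hδ : 0 ≤ δ) {Y : Matrix (Fin m) (Fin n) ℝ} {U : Matrix (Fin m) (Fin r) ℝ} {σ : Fin r → ℝ}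
    {V : Matrix (Fin n) (Fin r) ℝ} (h : IsSVD Y U σ V) {s : Fin r → ℝ}
    (hs : IsVecSol α δ η σ s) {X : Matrix (Fin m) (Fin n) ℝ} (hX : IsMatSol α δ η Y X) :
    X = U * Matrix.diagonal s * V.transpose := by
  obtain ⟨h1, h2⟩ := matObj_ge hα hδ h hX.1
  have h3 := hX.2 _ (isMatSol_of_isVecSol hα hδ h hs).1
  rw [matObj_diagonal hα δ h] at h3
  have h4 := hs.2 _ h1
  have h5 := frobSq_nonneg (X - U * Matrix.diagonal (diagCoeff U V X) * V.transpose)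
  have h6 : diagCoeff U V X = s := by
    refine IsVecSol.unique (one_le_of_cases hα) hδ ⟨h1, fun s' hs' => ?_⟩ hs
    have := hs.2 s' hs'
    linarith
  rw [h6] at h2 h5
  exact sub_eq_zero.mp (eq_zero_of_frobSq_eq_zero (by linarith))

/-! ### Optimality certificates and closed forms for the vector problem -/

/-- Sufficient optimality condition for the vector problem: `q - s` is aligned with `s`, and its
dual norm `D` is compatible with `δ` and the constraint. -/
theorem isVecSol_of_dual {α : ENNReal} (hα : 1 ≤ α) {δ η D : ℝ} {p : ℕ} {q s : Fin p → ℝ}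
    (hfeas : ellNorm α s ≤ η) (hdual : ∀ s', ∑ i, (q i - s i) * s' i ≤ D * ellNorm α s')
    (halign : D * ellNorm α s ≤ ∑ i, (q i - s i) * s i)
    (hcompat : ∀ x, 0 ≤ x → x ≤ η → (D - δ) * (x - ellNorm α s) ≤ 0) : IsVecSol α δ η q s := by
  refine ⟨hfeas, fun s' hs' => ?_⟩
  have h1 := hcompat _ (ellNorm_nonneg hα s') hs'
  have h2 := hdual s'
  have h3 : ∑ i, (s' i - q i) ^ 2 = ∑ i, (s i - q i) ^ 2 - 2 * ∑ i, (q i - s i) * s' i +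
      2 * ∑ i, (q i - s i) * s i + ∑ i, (s' i - s i) ^ 2 := by
    rw [Finset.mul_sum, Finset.mul_sum, ← Finset.sum_sub_distrib, ← Finset.sum_add_distrib,
      ← Finset.sum_add_distrib]
    exact Finset.sum_congr rfl fun i _ => by ring
  have h4 : 0 ≤ ∑ i, (s' i - s i) ^ 2 := Finset.sum_nonneg fun _ _ => sq_nonneg _
  -- The objective at `s'` exceeds that at `s` by at least `(δ - D) * (‖s'‖ - ‖s‖)`, which `hcompat`
  -- makes nonnegative.
  simp only [vecObj]
  nlinarith

/-- The length `x` of the solution minimizes `δ x + ½ (x - N)²` on `[0, η]`. The residual is a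
multiple of `q` of length `D = N - x`, so Cauchy–Schwarz is the dual inequality. -/
theorem isVecSol_two {δ η : ℝ} (hδ : 0 ≤ δ) (hη : 0 ≤ η) {p : ℕ} (q : Fin p → ℝ) :
    IsVecSol 2 δ η q fun i => min (max 0 (Real.sqrt (∑ i, q i ^ 2) - δ)) η /
      Real.sqrt (∑ i, q i ^ 2) * q i := by
  set N := Real.sqrt (∑ i, q i ^ 2) with hN
  set x := min (max 0 (N - δ)) η with hx
  have hN0 : 0 ≤ N := Real.sqrt_nonneg _
  have hNsq : ∑ i, q i ^ 2 = N ^ 2 :=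
    (Real.sq_sqrt (Finset.sum_nonneg fun _ _ => sq_nonneg _)).symm
  have hx0 : 0 ≤ x := le_min (le_max_left _ _) hη
  have hxη : x ≤ η := min_le_right _ _
  have hxN : x ≤ N := (min_le_left _ _).trans (max_le hN0 (by linarith))
  have hxz : N = 0 → x = 0 := fun h => le_antisymm (h ▸ hxN) hx0
  -- For `N = 0` this uses that `x ≤ N` forces `x = 0`.
  have hcN : x / N * N = x := by
    by_cases h : N = 0
    · simp [h, hxz h]
    · field_simp
  have hnorm : ellNorm 2 (fun i => x / N * q i) = x := by
    rw [ellNorm_two]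
    simp_rw [mul_pow]
    rw [← Finset.mul_sum, hNsq, ← mul_pow, hcN, Real.sqrt_sq hx0]
  refine isVecSol_of_dual (by norm_num) (D := N - x) (hnorm.trans_le hxη) ?_ ?_ ?_
  · intro s'
    have h1 : ∑ i, (q i - x / N * q i) * s' i = (1 - x / N) * ∑ i, q i * s' i := by
      rw [Finset.mul_sum]; exact Finset.sum_congr rfl fun i _ => by ring
    have h2 : ∑ i, q i * s' i ≤ N * ellNorm 2 s' := by
      rw [ellNorm_two]
      exact Real.sum_mul_le_sqrt_mul_sqrt _ _ _
    have h3 : 0 ≤ 1 - x / N := sub_nonneg.mpr (div_le_one_of_le₀ hxN hN0)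
    rw [h1]
    calc _ ≤ (1 - x / N) * (N * ellNorm 2 s') := mul_le_mul_of_nonneg_left h2 h3
      _ = (N - x / N * N) * ellNorm 2 s' := by ring
      _ = _ := by rw [hcN]
  · rw [hnorm]
    have h1 : ∑ i, (q i - x / N * q i) * (x / N * q i) = (1 - x / N) * (x / N) * ∑ i, q i ^ 2 := by
      rw [Finset.mul_sum]; exact Finset.sum_congr rfl fun i _ => by ring
    rw [h1, hNsq]
    have : (1 - x / N) * (x / N) * N ^ 2 = (N - x / N * N) * (x / N * N) := by ring
    rw [this, hcN]
  · intro y hy0 hyη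
    rw [hnorm]
    rcases le_total (max 0 (N - δ)) η with h | h
    · have hxe : x = max 0 (N - δ) := min_eq_left h
      rcases le_total 0 (N - δ) with h' | h'
      · rw [max_eq_right h'] at hxe
        rw [hxe]; apply le_of_eq; ring
      · rw [max_eq_left h'] at hxe
        rw [hxe]; nlinarith
    · have hxe : x = η := min_eq_right h
      rw [hxe]
      rcases le_max_iff.mp h with h' | h'
      · have : y - η = 0 := by linarith
        rw [this, mul_zero]
      · exact mul_nonpos_of_nonneg_of_nonpos (by linarith) (by linarith)

/-- The projection of `x` to the interval `[-l, l]`. -/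
noncomputable def clip (l x : ℝ) : ℝ := max (-l) (min x l)

theorem abs_clip_le {l : ℝ} (hl : 0 ≤ l) (x : ℝ) : |clip l x| ≤ l := by
  rw [clip, abs_le]
  exact ⟨le_max_left _ _, max_le (by linarith) (min_le_right _ _)⟩

theorem clip_cases {l : ℝ} (hl : 0 ≤ l) (x : ℝ) :
    (|x| ≤ l ∧ clip l x = x) ∨ (l < x ∧ |x| = x ∧ clip l x = l) ∨
      (x < -l ∧ |x| = -x ∧ clip l x = -l) := by
  rcases le_or_gt |x| l with h | h
  · left
    refine ⟨h, ?_⟩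
    rw [abs_le] at h
    rw [clip, min_eq_left h.2, max_eq_right h.1]
  · right
    rcases lt_abs.mp h with h | h
    · left
      exact ⟨h, abs_of_nonneg (by linarith), by
        rw [clip, min_eq_right h.le, max_eq_right (by linarith)]⟩
    · right
      exact ⟨by linarith, abs_of_nonpos (by linarith), by
        rw [clip, min_eq_left (by linarith), max_eq_left (by linarith)]⟩

theorem abs_sub_clip {l : ℝ} (hl : 0 ≤ l) (x : ℝ) : |x - clip l x| = max (|x| - l) 0 := by
  rcases clip_cases hl x with ⟨h1, h2⟩ | ⟨h1, h2, h3⟩ | ⟨h1, h2, h3⟩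
  · rw [h2, max_eq_right (by linarith)]; simp
  · rw [h3, h2, max_eq_left (by linarith), abs_of_nonneg (by linarith)]
  · rw [h3, h2, max_eq_left (by linarith), abs_of_nonpos (by linarith)]; ring

/-- Complementary slackness: where the remainder is nonzero, the clipped value is `l` times its
sign. -/
theorem sub_clip_mul_clip {l : ℝ} (hl : 0 ≤ l) (x : ℝ) :
    (x - clip l x) * clip l x = l * |x - clip l x| := by
  rcases clip_cases hl x with ⟨h1, h2⟩ | ⟨h1, h2, h3⟩ | ⟨h1, h2, h3⟩
  · rw [h2]; simp
  · rw [h3, abs_of_nonneg (by linarith)]; ring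
  · rw [h3, abs_of_nonpos (by linarith)]; ring

/-- The part of the vector `a` that lies above the level `l`. -/
noncomputable def excess {p : ℕ} (a : Fin p → ℝ) (l : ℝ) : ℝ := ∑ i, max (a i - l) 0

theorem excess_antitone {p : ℕ} (a : Fin p → ℝ) : Antitone (excess a) := fun _ _ h =>
  Finset.sum_le_sum fun _ _ => max_le_max_right _ (by linarith)

/-- `l` is a nonnegative level above which `a` has the part `c`, or zero if `a` is too small. -/
structure IsLevel {p : ℕ} (a : Fin p → ℝ) (c l : ℝ) : Prop where
  nonneg : 0 ≤ l
  excess_le : excess a l ≤ c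
  excess_eq : 0 < l → excess a l = c

/-- The residual is `q` clipped at `k`, so its dual norm is at most `D = k`. Either `k = δ`, or `k =
l > δ` and the constraint is active because the excess above `l` is `η`. -/
theorem isVecSol_one {δ η l : ℝ} (hδ : 0 ≤ δ) {p : ℕ} (q : Fin p → ℝ)
    (hl : IsLevel (fun i => |q i|) η l) :
    IsVecSol 1 δ η q fun i => q i - clip (max l δ) (q i) := by
  set k := max l δ with hk
  have hk0 : 0 ≤ k := hδ.trans (le_max_right _ _)
  have hnorm : ellNorm 1 (fun i => q i - clip k (q i)) = excess (fun i => |q i|) k := by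
    rw [ellNorm_one]
    exact Finset.sum_congr rfl fun i _ => abs_sub_clip hk0 _
  refine isVecSol_of_dual le_rfl (D := k) ?_ ?_ ?_ ?_
  · rw [hnorm]
    exact (excess_antitone _ (le_max_left _ _)).trans hl.excess_le
  · intro s'
    rw [ellNorm_one, Finset.mul_sum]
    refine Finset.sum_le_sum fun i _ => ?_
    calc (q i - (q i - clip k (q i))) * s' i ≤ |(q i - (q i - clip k (q i))) * s' i| :=
          le_abs_self _
      _ = |clip k (q i)| * |s' i| := by rw [abs_mul, sub_sub_cancel]
      _ ≤ _ := mul_le_mul_of_nonneg_right (abs_clip_le hk0 _) (abs_nonneg _)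
  · rw [ellNorm_one, Finset.mul_sum]
    refine (Finset.sum_congr rfl fun i _ => ?_).le
    rw [← sub_clip_mul_clip hk0, sub_sub_cancel, mul_comm]
  · intro x _ hxη
    rw [hnorm]
    rcases le_or_gt l δ with h | h
    · simp [hk, max_eq_right h]
    · have hkl : k = l := max_eq_left h.le
      rw [hkl, hl.excess_eq (hδ.trans_lt h)]
      exact mul_nonpos_of_nonneg_of_nonpos (by linarith) (by linarith)

/-- Here `δ` takes the place of `η` in the level, and the dual norm `D` of the residual is the
excess above `t`. For `l ≤ η`, either `D = δ`, or `l = 0`, the solution is zero and `D ≤ δ`. For `l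
> η` one has `D ≥ δ`; if strict, some entry is clipped, so the norm equals `η`. -/
theorem isVecSol_top {δ η l : ℝ} (hδ : 0 ≤ δ) (hη : 0 ≤ η) {p : ℕ} (q : Fin p → ℝ)
    (hl : IsLevel (fun i => |q i|) δ l) :
    IsVecSol ⊤ δ η q fun i => clip (min l η) (q i) := by
  set t := min l η with ht
  have ht0 : 0 ≤ t := le_min hl.nonneg hη
  have hnorm : ellNorm ⊤ (fun i => clip t (q i)) ≤ t := by
    rw [ellNorm_top, pi_norm_le_iff_of_nonneg ht0]
    exact fun i => abs_clip_le ht0 _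
  have hnorm0 := ellNorm_nonneg le_top (fun i => clip t (q i))
  have hexc : ∑ i, |q i - clip t (q i)| = excess (fun i => |q i|) t :=
    Finset.sum_congr rfl fun i _ => abs_sub_clip ht0 _
  have hexc0 : 0 ≤ excess (fun i => |q i|) t := Finset.sum_nonneg fun _ _ => le_max_right _ _
  refine isVecSol_of_dual le_top (D := excess (fun i => |q i|) t) (hnorm.trans (min_le_right _ _))
    ?_ ?_ ?_
  · intro s'
    rw [ellNorm_top, ← hexc, Finset.sum_mul]
    refine Finset.sum_le_sum fun i _ => ?_
    calc (q i - clip t (q i)) * s' i ≤ |(q i - clip t (q i)) * s' i| := le_abs_self _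
      _ = |q i - clip t (q i)| * |s' i| := abs_mul _ _
      _ ≤ _ := mul_le_mul_of_nonneg_left (norm_le_pi_norm s' i) (abs_nonneg _)
  · refine (mul_le_mul_of_nonneg_left hnorm hexc0).trans ?_
    rw [← hexc, mul_comm, Finset.mul_sum]
    exact (Finset.sum_congr rfl fun i _ => (sub_clip_mul_clip ht0 _).symm).le
  · intro x hx0 hxη
    rcases le_or_gt l η with h | h
    · have htl : t = l := min_eq_left h
      rcases hl.nonneg.eq_or_lt with h0 | h0
      · have h1 : ellNorm ⊤ (fun i => clip t (q i)) = 0 := by linarith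
        have := hl.excess_le
        rw [h1, htl]
        exact mul_nonpos_of_nonpos_of_nonneg (by linarith) (by linarith)
      · rw [htl, hl.excess_eq h0]; simp
    · have htη : t = η := min_eq_right h.le
      have h1 : δ ≤ excess (fun i => |q i|) t := by
        rw [← hl.excess_eq (hη.trans_lt h)]
        exact excess_antitone _ (min_le_left _ _)
      rcases h1.eq_or_lt with h2 | h2
      · rw [← h2]; simp
      · have h3 : 0 < ∑ i, |q i - clip t (q i)| := by rw [hexc]; linarith
        obtain ⟨i, _, hi⟩ := Finset.exists_ne_zero_of_sum_ne_zero h3.ne'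
        have h4 : |clip t (q i)| = t := by
          rcases clip_cases ht0 (q i) with ⟨_, h⟩ | ⟨_, _, h⟩ | ⟨_, _, h⟩
          · simp [h] at hi
          · rw [h, abs_of_nonneg ht0]
          · rw [h, abs_neg, abs_of_nonneg ht0]
        have h5 : t ≤ ellNorm ⊤ (fun i => clip t (q i)) := by
          rw [ellNorm_top]
          have := norm_le_pi_norm (fun i => clip t (q i)) i
          rw [Real.norm_eq_abs] at this
          exact h4.symm.le.trans this
        exact mul_nonpos_of_nonneg_of_nonpos (by linarith) (by linarith)

/-- The level is determined by a set of entries that lie above it. -/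
theorem isLevel_of_finset {p : ℕ} (a : Fin p → ℝ) (ha : ∀ i, 0 ≤ a i) {c : ℝ} (hc : 0 ≤ c)
    (E : Finset (Fin p)) (hE : 1 ≤ p → E.Nonempty)
    (hin : ∀ i ∈ E, ∑ i ∈ E, a i - c ≤ E.card * a i)
    (hout : ∀ i ∉ E, E.card * a i ≤ ∑ i ∈ E, a i - c) :
    IsLevel a c (max 0 ((∑ i ∈ E, a i - c) / E.card)) := by
  rcases Nat.eq_zero_or_pos p with rfl | hp
  · have : (E.card : ℝ) = 0 := by simp [Finset.eq_empty_of_isEmpty E]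
    rw [this]
    exact ⟨by simp, by simpa [excess] using hc, by simp⟩
  have hK : (0 : ℝ) < E.card := by exact_mod_cast (hE hp).card_pos
  set S := ∑ i ∈ E, a i with hS
  set K : ℝ := (E.card : ℝ)
  -- At levels separating `E` from its complement the excess is affine in `l`; solving `S - K * l =
  -- c` gives the candidate level.
  have hsplit : ∀ l, (∀ i ∈ E, l ≤ a i) → (∀ i ∉ E, a i ≤ l) → excess a l = S - K * l := by
    intro l h1 h2
    rw [excess, ← Finset.sum_add_sum_compl E, Finset.sum_congr rfl fun i hi =>
      max_eq_left (sub_nonneg.mpr (h1 i hi)), Finset.sum_congr (s₁ := Eᶜ) rfl fun i hi =>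
      max_eq_right (sub_nonpos.mpr (h2 i (Finset.mem_compl.mp hi)))]
    simp [hS, K]
  rcases le_or_gt 0 ((S - c) / K) with h | h
  · have : excess a ((S - c) / K) = c := by
      rw [hsplit]
      · field_simp; ring
      · intro i hi; rw [div_le_iff₀ hK, mul_comm]; exact hin i hi
      · intro i hi; rw [le_div_iff₀ hK, mul_comm]; exact hout i hi
    rw [max_eq_right h]
    exact ⟨h, this.le, fun _ => this⟩
  · rw [max_eq_left h.le]
    have h1 : S - c < 0 := by
      by_contra! h'
      exact absurd (div_nonneg h' hK.le) (not_le.mpr h)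
    refine ⟨le_rfl, ?_, fun h => absurd h (lt_irrefl _)⟩
    rw [hsplit 0 (fun i _ => ha i) fun i hi => ?_]
    · linarith
    · have := hout i hi
      nlinarith [ha i]

namespace RealRAM

/-! ### Memory updates and preserved memory -/

@[simp] theorem State.setNat_nat (st : State) (i k j : ℕ) :
    (st.setNat i k).nat j = if j = i then k else st.nat j := Function.update_apply _ _ _ _
@[simp] theorem State.setNat_real (st : State) (i k : ℕ) : (st.setNat i k).real = st.real := rfl
@[simp] theorem State.setNat_arr (st : State) (i k : ℕ) : (st.setNat i k).arr = st.arr := rfl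
@[simp] theorem State.setReal_nat (st : State) (i : ℕ) (x : ℝ) :
    (st.setReal i x).nat = st.nat := rfl
@[simp] theorem State.setReal_real (st : State) (i : ℕ) (x : ℝ) (j : ℕ) :
    (st.setReal i x).real j = if j = i then x else st.real j := Function.update_apply _ _ _ _
@[simp] theorem State.setReal_arr (st : State) (i : ℕ) (x : ℝ) :
    (st.setReal i x).arr = st.arr := rfl
@[simp] theorem State.setArr_nat (st : State) (a : ℕ) (f : ℕ → ℝ) :
    (st.setArr a f).nat = st.nat := rfl
@[simp] theorem State.setArr_real (st : State) (a : ℕ) (f : ℕ → ℝ) :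
    (st.setArr a f).real = st.real := rfl
@[simp] theorem State.setArr_arr (st : State) (a : ℕ) (f : ℕ → ℝ) (b : ℕ) :
    (st.setArr a f).arr b = if b = a then f else st.arr b := Function.update_apply _ _ _ _

/-- The natural registers that a program may write. -/
def Cmd.natWrites : Cmd → List ℕ
  | .setNat i _ => [i]
  | .svd _ _ r _ _ _ _ => [r]
  | .seq c d => c.natWrites ++ d.natWrites
  | .branch _ c d => c.natWrites ++ d.natWrites
  | .loop _ c => c.natWrites
  | _ => []

/-- The real registers that a program may write. -/
def Cmd.realWrites : Cmd → List ℕ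
  | .setReal i _ => [i]
  | .seq c d => c.realWrites ++ d.realWrites
  | .branch _ c d => c.realWrites ++ d.realWrites
  | .loop _ c => c.realWrites
  | _ => []

/-- The arrays that a program may write. -/
def Cmd.arrWrites : Cmd → List ℕ
  | .put a _ _ => [a]
  | .svd _ _ _ _ u s v => [u, s, v]
  | .seq c d => c.arrWrites ++ d.arrWrites
  | .branch _ c d => c.arrWrites ++ d.arrWrites
  | .loop _ c => c.arrWrites
  | _ => []

/-- The states agree on the part of memory that the program does not write. -/
structure Frame (c : Cmd) (st st' : State) : Prop where
  nat : ∀ i, i ∉ c.natWrites → st'.nat i = st.nat i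
  real : ∀ i, i ∉ c.realWrites → st'.real i = st.real i
  arr : ∀ a, a ∉ c.arrWrites → st'.arr a = st.arr a

theorem Frame.refl (c : Cmd) (st : State) : Frame c st st :=
  ⟨fun _ _ => rfl, fun _ _ => rfl, fun _ _ => rfl⟩

theorem Frame.trans {c : Cmd} {st₁ st₂ st₃ : State} (h : Frame c st₁ st₂) (h' : Frame c st₂ st₃) :
    Frame c st₁ st₃ :=
  ⟨fun i hi => (h'.nat i hi).trans (h.nat i hi), fun i hi => (h'.real i hi).trans (h.real i hi),
    fun i hi => (h'.arr i hi).trans (h.arr i hi)⟩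

theorem Frame.mono {c d : Cmd} {st st' : State} (h : Frame c st st')
    (hn : ∀ i ∈ c.natWrites, i ∈ d.natWrites) (hr : ∀ i ∈ c.realWrites, i ∈ d.realWrites)
    (ha : ∀ i ∈ c.arrWrites, i ∈ d.arrWrites) : Frame d st st' :=
  ⟨fun i hi => h.nat i fun h' => hi (hn i h'), fun i hi => h.real i fun h' => hi (hr i h'),
    fun i hi => h.arr i fun h' => hi (ha i h')⟩

/-- Write sets are computed from the program text, so for a concrete program the preservation of a
cell is settled by `decide` or `simp`. -/
theorem Exec.frame {O : Routine} {c : Cmd} {st st' : State} {t : ℕ} (h : Exec O c st t st') :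
    Frame c st st' := by
  induction h with
  | skip st => exact Frame.refl _ _
  | setNat st i e =>
    exact ⟨fun j hj => by simp_all [Cmd.natWrites], fun _ _ => rfl, fun _ _ => rfl⟩
  | setReal st i e =>
    exact ⟨fun _ _ => rfl, fun j hj => by simp_all [Cmd.realWrites], fun _ _ => rfl⟩
  | put st a i e =>
    exact ⟨fun _ _ => rfl, fun _ _ => rfl, fun j hj => by simp_all [Cmd.arrWrites]⟩
  | svd st m n r a u s v =>
    exact ⟨fun j hj => by simp_all [Cmd.natWrites, State.setFactors], fun _ _ => rfl,
      fun j hj => by simp_all [Cmd.arrWrites, State.setFactors]⟩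
  | seq _ _ ih₁ ih₂ =>
    exact (ih₁.mono (by simp +contextual [Cmd.natWrites]) (by simp +contextual [Cmd.realWrites])
      (by simp +contextual [Cmd.arrWrites])).trans (ih₂.mono (by simp +contextual [Cmd.natWrites])
      (by simp +contextual [Cmd.realWrites]) (by simp +contextual [Cmd.arrWrites]))
  | branchTrue _ _ ih =>
    exact ih.mono (by simp +contextual [Cmd.natWrites]) (by simp +contextual [Cmd.realWrites])
      (by simp +contextual [Cmd.arrWrites])
  | branchFalse _ _ ih =>
    exact ih.mono (by simp +contextual [Cmd.natWrites]) (by simp +contextual [Cmd.realWrites])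
      (by simp +contextual [Cmd.arrWrites])
  | loopTrue _ _ _ ih₁ ih₂ =>
    exact Frame.trans ⟨ih₁.nat, ih₁.real, ih₁.arr⟩ ih₂
  | loopFalse _ => exact Frame.refl _ _

/-! ### Program logic with time bounds -/

/-- Started in `st`, the program halts within `T` steps in a state with property `Q`. -/
def Runs (O : Routine) (c : Cmd) (st : State) (T : ℕ) (Q : State → Prop) : Prop :=
  ∃ t st', Exec O c st t st' ∧ t ≤ T ∧ Q st'

variable {O : Routine} {c d : Cmd} {b : Cmp} {st : State} {T T' T₁ T₂ : ℕ} {Q R : State → Prop}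

theorem Runs.of_le (h : Runs O c st T Q) (hT : T ≤ T') : Runs O c st T' Q := by
  obtain ⟨t, st', h1, h2, h3⟩ := h
  exact ⟨t, st', h1, h2.trans hT, h3⟩

theorem Runs.imp (h : Runs O c st T Q) (hQ : ∀ st', Frame c st st' → Q st' → R st') :
    Runs O c st T R := by
  obtain ⟨t, st', h1, h2, h3⟩ := h
  exact ⟨t, st', h1, h2, hQ st' h1.frame h3⟩

theorem Runs.setNat {i : ℕ} {e : NExp} (h : Q (st.setNat i (e.val st))) :
    Runs O (.setNat i e) st (e.cost + 1) Q := ⟨_, _, .setNat _ _ _, le_rfl, h⟩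

theorem Runs.setReal {i : ℕ} {e : RExp} (h : Q (st.setReal i (e.val st))) :
    Runs O (.setReal i e) st (e.cost + 1) Q := ⟨_, _, .setReal _ _ _, le_rfl, h⟩

theorem Runs.put {a : ℕ} {i : NExp} {e : RExp}
    (h : Q (st.setArr a (Function.update (st.arr a) (i.val st) (e.val st)))) :
    Runs O (.put a i e) st (i.cost + e.cost + 1) Q := ⟨_, _, .put _ _ _ _, le_rfl, h⟩

theorem Runs.seq (h : Runs O c st T₁ R) (h' : ∀ st₁, Frame c st st₁ → R st₁ → Runs O d st₁ T₂ Q) :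
    Runs O (.seq c d) st (T₁ + T₂) Q := by
  obtain ⟨t, st₁, h1, h2, h3⟩ := h
  obtain ⟨t', st₂, h4, h5, h6⟩ := h' st₁ h1.frame h3
  exact ⟨_, _, h1.seq h4, add_le_add h2 h5, h6⟩

theorem Runs.seqSetNat {i : ℕ} {e : NExp} (h : Runs O d (st.setNat i (e.val st)) T Q) :
    Runs O (.seq (.setNat i e) d) st (e.cost + 1 + T) Q :=
  Runs.seq (R := fun st₁ => st₁ = st.setNat i (e.val st)) (Runs.setNat rfl)
    fun _ _ h1 => by rw [h1]; exact h

theorem Runs.seqSetReal {i : ℕ} {e : RExp} (h : Runs O d (st.setReal i (e.val st)) T Q) :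
    Runs O (.seq (.setReal i e) d) st (e.cost + 1 + T) Q :=
  Runs.seq (R := fun st₁ => st₁ = st.setReal i (e.val st)) (Runs.setReal rfl)
    fun _ _ h1 => by rw [h1]; exact h

theorem Runs.seqPut {a : ℕ} {i : NExp} {e : RExp}
    (h : Runs O d (st.setArr a (Function.update (st.arr a) (i.val st) (e.val st))) T Q) :
    Runs O (.seq (.put a i e) d) st (i.cost + e.cost + 1 + T) Q :=
  Runs.seq (R := fun st₁ => st₁ = st.setArr a (Function.update (st.arr a) (i.val st) (e.val st)))
    (Runs.put rfl) fun _ _ h1 => by rw [h1]; exact h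

theorem Runs.branch (h₁ : b.holds st → Runs O c st T₁ Q) (h₂ : ¬ b.holds st → Runs O d st T₂ Q) :
    Runs O (.branch b c d) st (b.cost + max T₁ T₂) Q := by
  by_cases h : b.holds st
  · obtain ⟨t, st', h3, h4, h5⟩ := h₁ h
    exact ⟨_, _, .branchTrue h h3, by omega, h5⟩
  · obtain ⟨t, st', h3, h4, h5⟩ := h₂ h
    exact ⟨_, _, .branchFalse h h3, by omega, h5⟩

/-- Loop rule with an invariant that bounds the number of remaining iterations. -/
theorem Runs.loop (I : ℕ → State → Prop) {B : ℕ} (k : ℕ) (h0 : I k st)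
    (hstep : ∀ k st₁, Frame c st st₁ → I k st₁ → b.holds st₁ →
      ∃ l < k, Runs O c st₁ B (I l)) :
    Runs O (.loop b c) st (k * (b.cost + B) + b.cost)
      (fun st' => (∃ k, I k st') ∧ ¬ b.holds st') := by
  suffices ∀ k st₁, Frame c st st₁ → I k st₁ → Runs O (.loop b c) st₁ (k * (b.cost + B) + b.cost)
      (fun st' => (∃ k, I k st') ∧ ¬ b.holds st') from this k st (Frame.refl _ _) h0
  intro k
  induction k using Nat.strong_induction_on with
  | _ k ih =>
    intro st₁ hf hI
    by_cases hb : b.holds st₁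
    · obtain ⟨l, hl, t, st₂, h1, h2, h3⟩ := hstep k st₁ hf hI hb
      obtain ⟨t', st₃, h4, h5, h6⟩ := ih l hl st₂ (hf.trans h1.frame) h3
      refine ⟨_, _, .loopTrue hb h1 h4, ?_, h6⟩
      have : (l + 1) * (b.cost + B) ≤ k * (b.cost + B) := Nat.mul_le_mul_right _ hl
      rw [add_mul] at this
      omega
    · exact ⟨_, _, .loopFalse hb, by omega, ⟨k, hI⟩, hb⟩

/-- `for i = 0, …, n - 1 do c`, with `n` held by a register. -/
def forLoop (i n : ℕ) (c : Cmd) : Cmd :=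
  .seq (.setNat i (.const 0))
    (.loop (.natLT (.reg i) (.reg n)) (.seq c (.setNat i (.add (.reg i) (.const 1)))))

/-- Per round the increment costs 4 and the test 3; the initialization and the last test cost 5. The
measure for `Runs.loop` is the number `N - k` of remaining rounds. -/
theorem Runs.forLoop (I : ℕ → State → Prop) {i n N B : ℕ} (hN : st.nat n = N) (hin : i ≠ n)
    (hi : i ∉ c.natWrites) (hn : n ∉ c.natWrites) (h0 : I 0 (st.setNat i 0))
    (hstep : ∀ k st₁, Frame (forLoop i n c) st st₁ → k < N → st₁.nat i = k → I k st₁ →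
      Runs O c st₁ B fun st₂ => I (k + 1) (st₂.setNat i (k + 1))) :
    Runs O (forLoop i n c) st (N * (B + 7) + 5) (I N) := by
  have hfr : ∀ {st₁}, Frame (.seq c (.setNat i (.add (.reg i) (.const 1)))) (st.setNat i 0) st₁ →
      Frame (RealRAM.forLoop i n c) st st₁ := by
    intro st₁ h
    refine Frame.trans (st₂ := st.setNat i 0) ⟨fun j hj => ?_, fun _ _ => rfl, fun _ _ => rfl⟩ (h.mono ?_ ?_ ?_)
    · simp_all [RealRAM.forLoop, Cmd.natWrites]
    · simp +contextual [RealRAM.forLoop, Cmd.natWrites]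
    · simp +contextual [RealRAM.forLoop, Cmd.realWrites]
    · simp +contextual [RealRAM.forLoop, Cmd.arrWrites]
  have hnN : ∀ {st₁}, Frame (RealRAM.forLoop i n c) st st₁ → st₁.nat n = N := by
    intro st₁ h
    rw [h.nat n, hN]
    simp [RealRAM.forLoop, Cmd.natWrites, hn, Ne.symm hin]
  apply Runs.of_le
  · apply Runs.seqSetNat
    apply Runs.imp
    · refine Runs.loop (B := B + 4) (fun k st₁ => k ≤ N ∧ st₁.nat i = N - k ∧ I (N - k) st₁) N
        ⟨le_rfl, by simp [NExp.val], by simpa [NExp.val] using h0⟩ ?_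
      rintro k st₁ hf ⟨hkN, hk, hI⟩ hb
      have hf' := hfr hf
      simp only [Cmp.holds, NExp.val, hnN hf', hk] at hb
      refine ⟨k - 1, by omega, ?_⟩
      apply Runs.seq (hstep _ st₁ hf' hb hk hI)
      intro st₂ hf₂ hI₂
      apply Runs.setNat
      have h1 : N - (k - 1) = N - k + 1 := by omega
      simp only [NExp.val, hf₂.nat i hi, hk, h1]
      exact ⟨by omega, by simp, hI₂⟩
    · rintro st' hf ⟨⟨k, hkN, hk, hI⟩, hb⟩
      have hf' := hfr (hf.mono (by simp [Cmd.natWrites]) (by simp [Cmd.realWrites])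
        (by simp [Cmd.arrWrites]))
      simp only [Cmp.holds, NExp.val, hnN hf', hk] at hb
      have h1 : N - k = N := by omega
      rwa [h1] at hI
  · simp only [NExp.cost, Cmp.cost]
    have : 1 + 1 + 1 + (B + 4) = B + 7 := by ring
    rw [this]
    omega

/-! ### Derived expressions and the Euclidean program -/

/-- `|e|` -/
def RExp.abs (e : RExp) : RExp := .sqrt (.mul e e)

/-- `max e f` -/
def RExp.max (e f : RExp) : RExp := .div (.add (.add e f) (.abs (.sub e f))) (.const 2)

/-- `min e f` -/
def RExp.min (e f : RExp) : RExp := .div (.sub (.add e f) (.abs (.sub e f))) (.const 2)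

@[simp] theorem RExp.val_abs (st : State) (e : RExp) : (RExp.abs e).val st = |e.val st| := by
  simp [RExp.abs, RExp.val, Real.sqrt_mul_self_eq_abs]

@[simp] theorem RExp.val_max (st : State) (e f : RExp) :
    (RExp.max e f).val st = Max.max (e.val st) (f.val st) := by
  simp only [RExp.max, RExp.val, RExp.val_abs]
  rcases le_total (e.val st) (f.val st) with h | h
  · rw [max_eq_right h, abs_of_nonpos (by linarith)]; push_cast; ring
  · rw [max_eq_left h, abs_of_nonneg (by linarith)]; push_cast; ring

@[simp] theorem RExp.val_min (st : State) (e f : RExp) :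
    (RExp.min e f).val st = Min.min (e.val st) (f.val st) := by
  simp only [RExp.min, RExp.val, RExp.val_abs]
  rcases le_total (e.val st) (f.val st) with h | h
  · rw [min_eq_left h, abs_of_nonpos (by linarith)]; push_cast; ring
  · rw [min_eq_right h, abs_of_nonneg (by linarith)]; push_cast; ring


/-- Scaling program for the vector problem with the Euclidean norm. -/
def scaleProg : Cmd :=
  .seq (.setReal 2 (.const 0)) <|
  .seq (forLoop 1 0 (.setReal 2 (.add (.reg 2) (.mul (.get 0 (.reg 1)) (.get 0 (.reg 1)))))) <|
  .seq (.setReal 2 (.sqrt (.reg 2))) <|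
  .seq (.setReal 3 (.div (.min (.max (.const 0) (.sub (.reg 2) (.reg 0))) (.reg 1)) (.reg 2))) <|
  forLoop 1 0 (.put 1 (.reg 1) (.mul (.reg 3) (.get 0 (.reg 1))))

theorem runs_scaleProg (O : Routine) (st : State) {p : ℕ} (q : Fin p → ℝ) {δ η : ℝ} (hδ : 0 ≤ δ)
    (hη : 0 ≤ η) (h0 : st.nat 0 = p) (h1 : st.real 0 = δ) (h2 : st.real 1 = η)
    (hq : HoldsVec (st.arr 0) q) :
    Runs O scaleProg st (100 * p + 100) fun st' =>
      ∃ s, HoldsVec (st'.arr 1) s ∧ IsVecSol 2 δ η q s := by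
  apply Runs.of_le
  · apply Runs.seqSetReal
    apply Runs.seq
    · apply Runs.forLoop (N := p)
        (I := fun k st₁ => st₁.real 2 = ∑ i ∈ Finset.range k, st.arr 0 i ^ 2)
      · simpa using h0
      · decide
      · decide
      · decide
      · simp [RExp.val]
      · intro k st₁ hf hk hi hI
        apply Runs.setReal
        have := hf.arr 0 (by decide)
        simp at this
        simp [RExp.val, NExp.val, hi, hI, this, Finset.sum_range_succ]
        ring
    intro st₁ hf₁ hI₁
    have hr0 := hf₁.real 0 (by decide)
    have hr1 := hf₁.real 1 (by decide)
    have hn0 := hf₁.nat 0 (by decide)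
    have ha0 := hf₁.arr 0 (by decide)
    simp at hr0 hr1 hn0 ha0
    apply Runs.seqSetReal
    apply Runs.seqSetReal
    apply Runs.imp
    -- For `q = 0` the machine divides by zero and obtains `0`, in agreement with the closed form of
    -- `isVecSol_two`.
    · apply Runs.forLoop (N := p) (fun k st₁ => ∀ i < k, st₁.arr 1 i =
        min (max 0 (Real.sqrt (∑ i, q i ^ 2) - δ)) η / Real.sqrt (∑ i, q i ^ 2) * st.arr 0 i)
      · simpa [hn0] using h0
      · decide
      · decide
      · decide
      · simp
      · intro k st₂ hf hk hi hI
        apply Runs.put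
        have h3 := hf.real 3 (by decide)
        have h4 := hf.arr 0 (by decide)
        have h5 : ∑ i ∈ Finset.range p, st.arr 0 i ^ 2 = ∑ i, q i ^ 2 := by
          rw [Finset.sum_range]; exact Finset.sum_congr rfl fun i _ => by rw [hq]
        simp [RExp.val, hI₁, hr0, hr1, h1, h2, ha0, h5] at h3 h4
        intro i hik
        by_cases h : i = k
        · simp [RExp.val, NExp.val, hi, h, h3, h4]
        · simp [RExp.val, NExp.val, hi, h, hI i (by omega)]
    · intro st' _ h
      refine ⟨_, ?_, isVecSol_two hδ hη q⟩
      intro i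
      rw [h i i.2, hq]
  · simp [RExp.cost, RExp.max, RExp.min, RExp.abs, NExp.cost]
    omega

theorem solvesVec_two : SolvesVec 2 scaleProg fun p => 100 * p + 100 := by
  refine ⟨by simp [scaleProg, Cmd.Elementary, forLoop], ?_⟩
  intro O p q δ η hδ hη st h0 h1 h2 hq
  obtain ⟨t, st', h3, h4, s, h5, h6⟩ := runs_scaleProg O st q hδ hη h0 h1 h2 hq
  exact ⟨t, st', s, h3, h4, h5, h6⟩

theorem isBigO_two : Asymptotics.IsBigO Filter.atTop (fun p : ℕ => ((100 * p + 100 : ℕ) : ℝ))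
    (fun p : ℕ => (p : ℝ)) := by
  refine Asymptotics.IsBigO.of_bound 200 ?_
  filter_upwards [Filter.eventually_ge_atTop 1] with p hp
  have : (1 : ℝ) ≤ p := by exact_mod_cast hp
  rw [Real.norm_of_nonneg (by positivity), Real.norm_of_nonneg (by positivity)]
  push_cast
  linarith


/-! ### Extraction of maxima with a tournament tree

The nodes `1, …, p - 1` are internal, node `k` has the children `2k` and `2k + 1`, and the nodes
`p, …, 2p - 1` are the leaves. -/

/-- Each internal node of the tree `f` with `p` leaves holds the maximum of its children. -/
def IsTournament (p : ℕ) (f : ℕ → ℝ) : Prop :=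
  ∀ k, 1 ≤ k → k < p → f k = max (f (k + k)) (f (k + k + 1))

/-- A node is at most its parent `k / 2`; climb to the root. -/
theorem IsTournament.le_root {p : ℕ} {f : ℕ → ℝ} (h : IsTournament p f) (k : ℕ) (hk : 1 ≤ k)
    (hkp : k < 2 * p) : f k ≤ f 1 := by
  induction k using Nat.strong_induction_on with
  | _ k ih =>
    rcases hk.eq_or_lt with rfl | hk1
    · exact le_rfl
    refine le_trans ?_ (ih (k / 2) (by omega) (by omega) (by omega))
    rw [h (k / 2) (by omega) (by omega)]
    rcases Nat.even_or_odd' k with ⟨l, hl | hl⟩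
    · refine le_trans (le_of_eq ?_) (le_max_left _ _)
      congr 1; omega
    · refine le_trans (le_of_eq ?_) (le_max_right _ _)
      congr 1; omega

/-- Recompute the tree node in register `2` from its children. -/
def pullProg : Cmd :=
  .put 2 (.reg 2) (.max (.get 2 (.add (.reg 2) (.reg 2)))
    (.get 2 (.add (.add (.reg 2) (.reg 2)) (.const 1))))

theorem runs_pullProg {O : Routine} {st : State} {Q : State → Prop}
    (h : Q (st.setArr 2 (Function.update (st.arr 2) (st.nat 2)
      (max (st.arr 2 (st.nat 2 + st.nat 2)) (st.arr 2 (st.nat 2 + st.nat 2 + 1)))))) :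
    Runs O pullProg st 40 Q := by
  apply Runs.of_le
  · apply Runs.put
    simpa [RExp.val, NExp.val] using h
  · simp [RExp.cost, RExp.max, RExp.abs, NExp.cost]

/-- Compute the internal nodes of the tree. -/
def buildProg : Cmd :=
  .seq (.setNat 2 (.reg 0)) (.loop (.natLT (.const 1) (.reg 2))
    (.seq (.setNat 2 (.sub (.reg 2) (.const 1))) pullProg))

theorem runs_buildProg (O : Routine) (st : State) {p : ℕ} (h0 : st.nat 0 = p) :
    Runs O buildProg st (60 * p + 10) fun st' =>
      IsTournament p (st'.arr 2) ∧ ∀ j, p ≤ j → st'.arr 2 j = st.arr 2 j := by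
  apply Runs.of_le
  · apply Runs.seqSetNat
    apply Runs.imp
    · apply Runs.loop (B := 44) (k := p) (fun k st₁ => st₁.nat 2 = k ∧ k ≤ p ∧
        (∀ j, 1 ≤ j → k ≤ j → j < p →
          st₁.arr 2 j = max (st₁.arr 2 (j + j)) (st₁.arr 2 (j + j + 1))) ∧
        ∀ j, p ≤ j → st₁.arr 2 j = st.arr 2 j)
      · refine ⟨by simpa [NExp.val] using h0, le_rfl, fun j _ h1 h2 => absurd h1 (by omega), by simp⟩
      · rintro k st₁ hf ⟨hk, hkp, h1, h2⟩ hb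
        simp only [Cmp.holds, NExp.val, hk] at hb
        refine ⟨k - 1, by omega, ?_⟩
        apply Runs.of_le
        · apply Runs.seqSetNat
          apply runs_pullProg
          simp only [NExp.val, hk, State.setArr_nat, State.setNat_nat, if_true, State.setNat_arr,
            State.setArr_arr]
          refine ⟨trivial, by omega, fun j hj hkj hjp => ?_, fun j hj => ?_⟩
          -- The children of a node `j ≥ k - 1` come strictly after `k - 1`, so the write cannot
          -- spoil them.
          · rw [Function.update_of_ne (a := j + j) (by omega),
              Function.update_of_ne (a := j + j + 1) (by omega)]
            by_cases hjk : j = k - 1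
            · rw [hjk, Function.update_self]
            · rw [Function.update_of_ne hjk]
              exact h1 j hj (by omega) hjp
          · rw [Function.update_of_ne (by omega)]
            exact h2 j hj
        · simp [NExp.cost]
    · rintro st' _ ⟨⟨k, hk, _, h1, h2⟩, hb⟩
      simp only [Cmp.holds, NExp.val, hk] at hb
      exact ⟨fun j hj hjp => h1 j hj (by omega) hjp, h2⟩
  · simp [NExp.cost, Cmp.cost]
    omega

/-- Descend from the root to a leaf that holds the maximum. -/
def descendProg : Cmd :=
  .seq (.setNat 2 (.const 1)) (.loop (.natLT (.reg 2) (.reg 0))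
    (.branch (.realLT (.get 2 (.add (.reg 2) (.reg 2))) (.get 2 (.reg 2)))
      (.setNat 2 (.add (.add (.reg 2) (.reg 2)) (.const 1)))
      (.setNat 2 (.add (.reg 2) (.reg 2)))))

/-- Each move at least doubles the node index, so `p ≤ node * 2 ^ k` bounds the remaining moves by
`k`. If the left child is smaller than the node, the right child holds the maximum. -/
theorem runs_descendProg (O : Routine) (st : State) {p L : ℕ} (h0 : st.nat 0 = p) (hp : 1 ≤ p)
    (hL : p ≤ 2 ^ L) (ht : IsTournament p (st.arr 2)) :
    Runs O descendProg st (20 * L + 10) fun st' =>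
      p ≤ st'.nat 2 ∧ st'.nat 2 < 2 * p ∧ st.arr 2 (st'.nat 2) = st.arr 2 1 := by
  apply Runs.of_le
  · apply Runs.seqSetNat
    apply Runs.imp
    · apply Runs.loop (B := 14) (k := L) (fun k st₁ => p ≤ st₁.nat 2 * 2 ^ k ∧ 1 ≤ st₁.nat 2 ∧
        st₁.nat 2 < 2 * p ∧ st.arr 2 (st₁.nat 2) = st.arr 2 1)
      · simp only [NExp.val, State.setNat_nat, if_true]
        exact ⟨by omega, le_rfl, by omega, trivial⟩
      · rintro k st₁ hf ⟨h1, h2, h3, h4⟩ hb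
        have hn := hf.nat 0 (by decide)
        have ha := hf.arr 2 (by decide)
        simp [h0] at hn ha
        simp only [Cmp.holds, NExp.val, hn] at hb
        have hk : k ≠ 0 := by rintro rfl; simp at h1; omega
        obtain ⟨l, rfl⟩ := Nat.exists_eq_succ_of_ne_zero hk
        have hpow : st₁.nat 2 * 2 ^ (l + 1) = (st₁.nat 2 + st₁.nat 2) * 2 ^ l := by ring
        rw [Nat.succ_eq_add_one, hpow] at h1
        refine ⟨l, by omega, ?_⟩
        have hmax := ht _ h2 hb
        apply Runs.of_le
        · apply Runs.branch
          · intro hlt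
            apply Runs.setNat
            simp only [Cmp.holds, RExp.val, NExp.val, ha] at hlt
            simp only [NExp.val, State.setNat_nat, if_true]
            refine ⟨h1.trans (Nat.mul_le_mul_right _ (by omega)), by omega, by omega, ?_⟩
            rw [← h4]
            rcases max_choice (st.arr 2 (st₁.nat 2 + st₁.nat 2))
              (st.arr 2 (st₁.nat 2 + st₁.nat 2 + 1)) with h | h
            · rw [hmax, h] at hlt; exact absurd hlt (lt_irrefl _)
            · rw [hmax, h]
          · intro hlt
            apply Runs.setNat
            simp only [Cmp.holds, RExp.val, NExp.val, ha, not_lt] at hlt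
            simp only [NExp.val, State.setNat_nat, if_true]
            refine ⟨h1, by omega, by omega, ?_⟩
            rw [← h4]
            exact le_antisymm (hmax ▸ le_max_left _ _) hlt
        · simp [NExp.cost, RExp.cost, Cmp.cost]
    · rintro st' hf ⟨⟨k, h1, h2, h3, h4⟩, hb⟩
      have hn := hf.nat 0 (by decide)
      simp [h0] at hn
      simp only [Cmp.holds, NExp.val, hn] at hb
      exact ⟨by omega, h3, h4⟩
  · simp [NExp.cost, Cmp.cost]
    omega

/-- Recompute the ancestors of the leaf in register `2`. -/
def ascendProg : Cmd :=
  .loop (.natLT (.const 1) (.reg 2)) (.seq (.setNat 2 (.half (.reg 2))) pullProg)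

/-- The tournament identity may fail only at proper ancestors of the current node. Recomputing the
parent repairs it there and can damage it only at the next ancestor. At the root no ancestor is
left. -/
theorem runs_ascendProg (O : Routine) (st : State) {p L k₀ : ℕ} (h2 : st.nat 2 = k₀)
    (hk₁ : 1 ≤ k₀) (hkp : k₀ < 2 * p) (hL : k₀ < 2 ^ (L + 1))
    (ht : ∀ j, 1 ≤ j → j < p →
      st.arr 2 j = max (st.arr 2 (j + j)) (st.arr 2 (j + j + 1)) ∨ ∃ i, j = k₀ / 2 ^ (i + 1)) :
    Runs O ascendProg st (60 * L + 10) fun st' =>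
      IsTournament p (st'.arr 2) ∧ ∀ j, p ≤ j → st'.arr 2 j = st.arr 2 j := by
  apply Runs.of_le
  · apply Runs.imp
    · apply Runs.loop (B := 44) (k := L) (fun k st₁ => 1 ≤ st₁.nat 2 ∧ st₁.nat 2 < 2 * p ∧
        st₁.nat 2 < 2 ^ (k + 1) ∧
        (∀ j, 1 ≤ j → j < p → st₁.arr 2 j = max (st₁.arr 2 (j + j)) (st₁.arr 2 (j + j + 1)) ∨
          ∃ i, j = st₁.nat 2 / 2 ^ (i + 1)) ∧
        ∀ j, p ≤ j → st₁.arr 2 j = st.arr 2 j)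
      · rw [h2]
        exact ⟨hk₁, hkp, hL, ht, fun _ _ => rfl⟩
      · rintro k st₁ hf ⟨h1, h2, h3, h4, h5⟩ hb
        simp only [Cmp.holds, NExp.val] at hb
        have hk : k ≠ 0 := by rintro rfl; simp at h3; omega
        obtain ⟨l, rfl⟩ := Nat.exists_eq_succ_of_ne_zero hk
        refine ⟨l, by omega, ?_⟩
        apply Runs.of_le
        · apply Runs.seqSetNat
          apply runs_pullProg
          simp only [NExp.val, State.setArr_nat, State.setNat_nat, if_true, State.setNat_arr,
              State.setArr_arr]
          set m := st₁.nat 2 / 2 with hm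
          refine ⟨by omega, by omega, ?_, fun j hj hjp => ?_, fun j hj => ?_⟩
          · rw [Nat.succ_eq_add_one, pow_succ] at h3
            omega
          · by_cases hjm : j = m
            · left
              rw [hjm, Function.update_self, Function.update_of_ne (by omega),
                Function.update_of_ne (by omega)]
            · rw [Function.update_of_ne hjm]
              -- If `j` is the parent of the rewritten node `m`, it is the nearest remaining
              -- ancestor.
              by_cases hc : j + j = m ∨ j + j + 1 = m
              · right
                exact ⟨0, by simp; omega⟩
              · push Not at hc
                rw [Function.update_of_ne hc.1, Function.update_of_ne hc.2]
                refine (h4 j hj hjp).imp_right ?_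
                rintro ⟨i, hi⟩
                rcases i with _ | i
                · simp at hi; omega
                · refine ⟨i, ?_⟩
                  rw [hm, Nat.div_div_eq_div_mul, hi, pow_succ' 2 (i + 1)]
          · rw [Function.update_of_ne (by omega)]
            exact h5 j hj
        · simp [NExp.cost]
    · rintro st' hf ⟨⟨k, h1, h2, h3, h4, h5⟩, hb⟩
      simp only [Cmp.holds, NExp.val] at hb
      have hone : st'.nat 2 = 1 := by omega
      refine ⟨fun j hj hjp => (h4 j hj hjp).resolve_right ?_, h5⟩
      rintro ⟨i, hi⟩
      have : (1 : ℕ) / 2 ^ (i + 1) = 0 := Nat.div_eq_of_lt (Nat.one_lt_two_pow (by omega))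
      rw [hone, this] at hi
      omega
  · simp [NExp.cost, Cmp.cost]
    omega

/-- Remove the maximum from the tree. -/
def extractProg : Cmd :=
  .seq descendProg (.seq (.put 2 (.reg 2) (.const (-1))) ascendProg)

theorem runs_extractProg (O : Routine) (st : State) {p L : ℕ} (h0 : st.nat 0 = p) (hp : 1 ≤ p)
    (hL : p ≤ 2 ^ L) (ht : IsTournament p (st.arr 2)) :
    Runs O extractProg st (80 * L + 30) fun st' => ∃ i : Fin p, st.arr 2 (p + i) = st.arr 2 1 ∧
      IsTournament p (st'.arr 2) ∧
      ∀ j : Fin p, st'.arr 2 (p + j) = if j = i then -1 else st.arr 2 (p + j) := by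
  apply Runs.of_le
  · apply Runs.seq (runs_descendProg O st h0 hp hL ht)
    rintro st₁ hf ⟨h1, h2, h3⟩
    have ha := hf.arr 2 (by decide)
    apply Runs.seqPut
    apply Runs.imp
    · apply runs_ascendProg (p := p) (L := L) (k₀ := st₁.nat 2)
      · rfl
      · omega
      · omega
      · rw [pow_succ]; omega
      · intro j hj hjp
        simp only [NExp.val, State.setArr_arr, if_true, ha]
        -- Only the parent of the changed leaf can violate the identity.
        by_cases hc : j = st₁.nat 2 / 2
        · right; exact ⟨0, by simpa using hc⟩
        · left
          rw [Function.update_of_ne (by omega), Function.update_of_ne (by omega),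
            Function.update_of_ne (by omega)]
          exact ht j hj hjp
    · rintro st' _ ⟨h4, h5⟩
      refine ⟨⟨st₁.nat 2 - p, by omega⟩, ?_, h4, fun j => ?_⟩
      · simp only [Nat.add_sub_cancel' h1, h3]
      · rw [h5 _ (by omega)]
        simp only [NExp.val, RExp.val, State.setArr_arr, if_true, ha, Function.update_apply,
          Fin.ext_iff]
        have : p + (j : ℕ) = st₁.nat 2 ↔ (j : ℕ) = st₁.nat 2 - p := by omega
        simp only [this]
        norm_num
  · simp [NExp.cost, RExp.cost]
    omega


/-! ### The level by greedy extraction of maxima -/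

/-- Compute a level of the vector of absolute values: the input is the vector in array `0`, its
dimension in natural register `0` and the part above the level in real register `2`, the output is
in real register `3`. -/
def levelProg : Cmd :=
  .seq (forLoop 1 0 (.put 2 (.add (.reg 0) (.reg 1)) (.abs (.get 0 (.reg 1))))) <|
  .seq buildProg <|
  .seq (.setReal 4 (.const 0)) <|
  .seq (.setReal 5 (.const 0)) <|
  .seq (.setNat 3 (.const 0)) <|
  .seq (.loop (.natLT (.reg 3) (.reg 0))
    -- With sum `S` and count `K` of the extracted entries, the test asks whether the next maximum
    -- lies below `(S - c) / K`. The product form fails at `S = K = 0` because `c ≥ 0`, so the first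
    -- maximum is always extracted. The true branch leaves the loop by setting the counter to `p`.
    (.branch (.realLT (.mul (.reg 5) (.get 2 (.const 1))) (.sub (.reg 4) (.reg 2)))
      (.setNat 3 (.reg 0))
      (.seq (.setReal 4 (.add (.reg 4) (.get 2 (.const 1)))) <|
        .seq (.setReal 5 (.add (.reg 5) (.const 1))) <|
        .seq (.setNat 3 (.add (.reg 3) (.const 1))) extractProg))) <|
  .setReal 3 (.max (.const 0) (.div (.sub (.reg 4) (.reg 2)) (.reg 5)))

/-- The state of the tree after the extraction of the entries in `E`. -/
structure Extracted {p : ℕ} (a : Fin p → ℝ) (c : ℝ) (E : Finset (Fin p)) (st : State) : Prop where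
  tree : IsTournament p (st.arr 2)
  leaf : ∀ i : Fin p, st.arr 2 (p + i) = if i ∈ E then -1 else a i
  sum : st.real 4 = ∑ i ∈ E, a i
  card : st.real 5 = E.card
  le : ∀ i ∈ E, ∀ j ∉ E, a j ≤ a i
  above : ∀ i ∈ E, ∑ i ∈ E, a i - c ≤ E.card * a i

theorem runs_levelProg (O : Routine) (st : State) {p L : ℕ} (q : Fin p → ℝ) {c : ℝ} (hc : 0 ≤ c)
    (h0 : st.nat 0 = p) (h2 : st.real 2 = c) (hq : HoldsVec (st.arr 0) q) (hL : p ≤ 2 ^ L) :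
    Runs O levelProg st (p * (80 * L + 200) + 100) fun st' =>
      IsLevel (fun i => |q i|) c (st'.real 3) := by
  set a : Fin p → ℝ := fun i => |q i| with ha
  have ha0 : ∀ i, 0 ≤ a i := fun i => abs_nonneg _
  apply Runs.of_le
  · apply Runs.seq
    · apply Runs.forLoop (N := p) (I := fun k st₁ => ∀ i < k, st₁.arr 2 (p + i) = |st.arr 0 i|)
      · exact h0
      · decide
      · decide
      · decide
      · simp
      · intro k st₁ hf hk hi hI
        have hn := hf.nat 0 (by decide)
        have ha := hf.arr 0 (by decide)
        apply Runs.put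
        intro i hik
        by_cases h : i = k
        · simp [NExp.val, RExp.val, hn, ha, hi, h0, h]
        · simp [NExp.val, hn, hi, h0, h, hI i (by omega)]
    intro st₁ hf₁ hleaf
    have hn₁ := hf₁.nat 0 (by decide)
    have hr₁ := hf₁.real 2 (by decide)
    rw [h0] at hn₁
    rw [h2] at hr₁
    apply Runs.seq (runs_buildProg O st₁ hn₁)
    rintro st₂ hf₂ ⟨htree, hkeep⟩
    have hn₂ := hf₂.nat 0 (by decide)
    have hr₂ := hf₂.real 2 (by decide)
    rw [hn₁] at hn₂
    rw [hr₁] at hr₂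
    apply Runs.seqSetReal
    apply Runs.seqSetReal
    apply Runs.seqSetNat
    apply Runs.seq
    -- Either the counter equals the number of extracted entries and `k` entries remain, or the
    -- early exit has certified that every other entry lies below the candidate level.
    · apply Runs.loop (B := 80 * L + 60) (k := p) (fun k st₃ => ∃ E : Finset (Fin p),
        Extracted a c E st₃ ∧ ((k + E.card = p ∧ st₃.nat 3 = E.card) ∨
          (st₃.nat 3 = p ∧ E.Nonempty ∧
            ∀ i ∉ E, E.card * a i ≤ ∑ i ∈ E, a i - c)))
      · refine ⟨∅, ⟨by simpa using htree, fun i => ?_, ?_, ?_, by simp, by simp⟩, Or.inl ?_⟩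
        · simp [hkeep, hleaf i i.2, hq i, ha]
        · simp [RExp.val]
        · simp [RExp.val]
        · simp [NExp.val]
      · rintro k st₃ hf₃ ⟨E, hE, hk⟩ hb
        have hn₃ := hf₃.nat 0 (by decide)
        have hr₃ := hf₃.real 2 (by decide)
        simp [hn₂] at hn₃
        simp [hr₂] at hr₃
        simp only [Cmp.holds, NExp.val, hn₃] at hb
        obtain ⟨hk, hcnt⟩ : k + E.card = p ∧ st₃.nat 3 = E.card := by
          rcases hk with hk | ⟨hk, _⟩
          · exact hk
          · omega
        have hp : 1 ≤ p := by omega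
        refine ⟨k - 1, by omega, ?_⟩
        have hroot : ∀ j ∉ E, a j ≤ st₃.arr 2 1 := by
          intro j hj
          have := hE.tree.le_root (p + j) (by omega) (by omega)
          rwa [hE.leaf, if_neg hj] at this
        obtain ⟨j₀, hj₀⟩ : ∃ j, j ∉ E := by
          by_contra! h
          have : E = Finset.univ := Finset.eq_univ_iff_forall.mpr h
          rw [this, Finset.card_fin] at hcnt
          omega
        apply Runs.of_le
        · apply Runs.branch
          · intro hlt
            simp only [Cmp.holds, RExp.val, NExp.val, hE.sum, hE.card, hr₃] at hlt
            apply Runs.setNat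
            refine ⟨E, ⟨hE.tree, hE.leaf, hE.sum, hE.card, hE.le, hE.above⟩, ?_⟩
            by_cases hne : E.Nonempty
            · refine Or.inr ⟨by simpa [NExp.val] using hn₃, hne, fun i hi => ?_⟩
              exact (mul_le_mul_of_nonneg_left (hroot i hi) (Nat.cast_nonneg _)).trans hlt.le
            · rw [Finset.not_nonempty_iff_eq_empty] at hne
              subst hne
              simp at hlt
              linarith
          · intro hge
            simp only [Cmp.holds, RExp.val, NExp.val, hE.sum, hE.card, hr₃, not_lt] at hge
            apply Runs.seqSetReal
            apply Runs.seqSetReal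
            apply Runs.seqSetNat
            apply Runs.imp
            · apply runs_extractProg O _ (p := p) (L := L) (by simpa using hn₃) hp hL
              simpa using hE.tree
            · rintro st₄ hf₄ ⟨i, hi, htree', hleaf'⟩
              have hs := hf₄.real 4 (by decide)
              have hK := hf₄.real 5 (by decide)
              have hN := hf₄.nat 3 (by decide)
              simp [RExp.val, NExp.val, hE.sum, hE.card, hcnt] at hs hK hN
              simp only [State.setNat_arr, State.setReal_arr] at hi hleaf'
              -- Extracted leaves carry `-1`, whereas the root dominates some absolute value not yet
              -- extracted, so an extracted leaf cannot be the maximum.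
              have hiE : i ∉ E := by
                intro h
                rw [hE.leaf, if_pos h] at hi
                linarith [hroot j₀ hj₀, ha0 j₀]
              have hai : a i = st₃.arr 2 1 := by rw [← hi, hE.leaf, if_neg hiE]
              refine ⟨insert i E, ⟨htree', fun j => ?_, ?_, ?_, ?_, ?_⟩, Or.inl ⟨?_, ?_⟩⟩
              · rw [hleaf', hE.leaf]
                by_cases hj : j = i <;> simp [hj]
              · rw [hs, Finset.sum_insert hiE, hai]; ring
              · rw [hK, Finset.card_insert_of_notMem hiE]; push_cast; ring
              · intro x hx y hy
                rw [Finset.mem_insert, not_or] at hy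
                rcases Finset.mem_insert.mp hx with rfl | hx
                · rw [hai]; exact hroot y hy.2
                · exact hE.le x hx y hy.2
              · intro x hx
                rw [Finset.sum_insert hiE, Finset.card_insert_of_notMem hiE]
                -- The failed test gives `S - c ≤ K * a i`; adding `a i` and using that `a i` is the
                -- smallest extracted entry restores the invariant `above`.
                have hx' : a i ≤ a x := by
                  rcases Finset.mem_insert.mp hx with rfl | hx
                  · exact le_rfl
                  · exact hE.le x hx i hiE
                have h5 := mul_le_mul_of_nonneg_left hx' (Nat.cast_nonneg (α := ℝ) (E.card + 1))
                rw [← hai] at hge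
                push_cast at h5 ⊢
                linarith
              · rw [Finset.card_insert_of_notMem hiE]; omega
              · rw [hN, Finset.card_insert_of_notMem hiE]
        · simp [NExp.cost, RExp.cost, Cmp.cost]
          omega
    rintro st₃ hf₃ ⟨⟨k, E, hE, hk⟩, hb⟩
    have hn₃ := hf₃.nat 0 (by decide)
    have hr₃ := hf₃.real 2 (by decide)
    simp [hn₂] at hn₃
    simp [hr₂] at hr₃
    simp only [Cmp.holds, NExp.val, hn₃] at hb
    apply Runs.setReal
    have hval : ((.max (.const 0) (.div (.sub (.reg 4) (.reg 2)) (.reg 5)) : RExp)).val st₃ =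
        max 0 ((∑ i ∈ E, a i - c) / E.card) := by
      simp [RExp.val, hE.sum, hE.card, hr₃]
    simp only [State.setReal_real, if_true, hval]
    rcases hk with ⟨hk, hcnt⟩ | ⟨_, hne, hout⟩
    · have hu : E = Finset.univ := by
        apply Finset.eq_univ_of_card
        rw [Fintype.card_fin]; omega
      refine isLevel_of_finset a ha0 hc E (fun hp => ?_) hE.above (by simp [hu])
      rw [← Finset.card_pos]; omega
    · exact isLevel_of_finset a ha0 hc E (fun _ => hne) hE.above hout
  · simp [NExp.cost, RExp.cost, Cmp.cost, RExp.max, RExp.abs]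
    ring_nf
    nlinarith

/-! ### Programs for the norms `ℓ_1` and `ℓ_∞` -/

/-- The expression `clip (reg 3) (arr 0 (reg 1))`. -/
def clipExp : RExp :=
  .max (.sub (.const 0) (.reg 3)) (.min (.get 0 (.reg 1)) (.reg 3))

theorem clipExp_val (st : State) :
    clipExp.val st = clip (st.real 3) (st.arr 0 (st.nat 1)) := by
  simp [clipExp, RExp.val, NExp.val, clip]

/-- Soft thresholding program for the vector problem with the norm `‖·‖₁`. -/
def softProg : Cmd :=
  .seq (.setReal 2 (.reg 1)) <| .seq levelProg <| .seq (.setReal 3 (.max (.reg 3) (.reg 0))) <|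
  forLoop 1 0 (.put 1 (.reg 1) (.sub (.get 0 (.reg 1)) clipExp))

/-- Clipping program for the vector problem with the norm `‖·‖_∞`. -/
def clipProg : Cmd :=
  .seq (.setReal 2 (.reg 0)) <| .seq levelProg <| .seq (.setReal 3 (.min (.reg 3) (.reg 1))) <|
  forLoop 1 0 (.put 1 (.reg 1) clipExp)

theorem runs_softProg (O : Routine) (st : State) {p L : ℕ} (q : Fin p → ℝ) {δ η : ℝ} (hδ : 0 ≤ δ)
    (hη : 0 ≤ η) (h0 : st.nat 0 = p) (h1 : st.real 0 = δ) (h2 : st.real 1 = η)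
    (hq : HoldsVec (st.arr 0) q) (hL : p ≤ 2 ^ L) :
    Runs O softProg st (p * (80 * L + 400) + 200) fun st' =>
      ∃ s, HoldsVec (st'.arr 1) s ∧ IsVecSol 1 δ η q s := by
  apply Runs.of_le
  · apply Runs.seqSetReal
    apply Runs.seq
    · apply runs_levelProg (p := p) (L := L) (c := η) O _ q hη
      · simpa using h0
      · simpa [RExp.val] using h2
      · simpa using hq
      · exact hL
    intro st₁ hf₁ hl
    have hr0 := hf₁.real 0 (by decide)
    have hn0 := hf₁.nat 0 (by decide)
    have ha0 := hf₁.arr 0 (by decide)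
    simp at hr0 hn0 ha0
    apply Runs.seqSetReal
    apply Runs.imp
    · apply Runs.forLoop (N := p) (I := fun k st₂ => ∀ i < k, st₂.arr 1 i =
        st.arr 0 i - clip (max (st₁.real 3) δ) (st.arr 0 i))
      · simpa [hn0] using h0
      · decide
      · decide
      · decide
      · simp
      · intro k st₂ hf hk hi hI
        apply Runs.put
        have h3 := hf.real 3 (by decide)
        have h4 := hf.arr 0 (by decide)
        simp [RExp.val, hr0, h1, ha0] at h3 h4
        intro i hik
        by_cases h : i = k
        · simp [RExp.val, NExp.val, clipExp_val, hi, h, h3, h4]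
        · simp [NExp.val, hi, h, hI i (by omega)]
    · intro st' _ h
      refine ⟨_, ?_, isVecSol_one hδ q hl⟩
      intro i
      rw [h i i.2, hq]
  · simp [RExp.cost, RExp.max, RExp.min, RExp.abs, NExp.cost, clipExp]
    ring_nf
    omega

theorem runs_clipProg (O : Routine) (st : State) {p L : ℕ} (q : Fin p → ℝ) {δ η : ℝ} (hδ : 0 ≤ δ)
    (hη : 0 ≤ η) (h0 : st.nat 0 = p) (h1 : st.real 0 = δ) (h2 : st.real 1 = η)
    (hq : HoldsVec (st.arr 0) q) (hL : p ≤ 2 ^ L) :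
    Runs O clipProg st (p * (80 * L + 400) + 200) fun st' =>
      ∃ s, HoldsVec (st'.arr 1) s ∧ IsVecSol ⊤ δ η q s := by
  apply Runs.of_le
  · apply Runs.seqSetReal
    apply Runs.seq
    · apply runs_levelProg (p := p) (L := L) (c := δ) O _ q hδ
      · simpa using h0
      · simpa [RExp.val] using h1
      · simpa using hq
      · exact hL
    intro st₁ hf₁ hl
    have hr1 := hf₁.real 1 (by decide)
    have hn0 := hf₁.nat 0 (by decide)
    have ha0 := hf₁.arr 0 (by decide)
    simp at hr1 hn0 ha0
    apply Runs.seqSetReal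
    apply Runs.imp
    · apply Runs.forLoop (N := p) (I := fun k st₂ => ∀ i < k, st₂.arr 1 i =
        clip (min (st₁.real 3) η) (st.arr 0 i))
      · simpa [hn0] using h0
      · decide
      · decide
      · decide
      · simp
      · intro k st₂ hf hk hi hI
        apply Runs.put
        have h3 := hf.real 3 (by decide)
        have h4 := hf.arr 0 (by decide)
        simp [RExp.val, hr1, h2, ha0] at h3 h4
        intro i hik
        by_cases h : i = k
        · simp [NExp.val, clipExp_val, hi, h, h3, h4]
        · simp [NExp.val, hi, h, hI i (by omega)]
    · intro st' _ h
      refine ⟨_, ?_, isVecSol_top hδ hη q hl⟩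
      intro i
      rw [h i i.2, hq]
  · simp [RExp.cost, RExp.max, RExp.min, RExp.abs, NExp.cost, clipExp]
    ring_nf
    omega

/-- A running time bound for the programs that use the tournament tree. -/
def logTime (p : ℕ) : ℕ := p * (80 * (Nat.log 2 p + 1) + 400) + 200

theorem le_two_pow_log (p : ℕ) : p ≤ 2 ^ (Nat.log 2 p + 1) :=
  (Nat.lt_pow_succ_log_self one_lt_two p).le

theorem solvesVec_one : SolvesVec 1 softProg logTime := by
  refine ⟨by simp [softProg, levelProg, buildProg, extractProg, descendProg, ascendProg, pullProg,
    Cmd.Elementary, forLoop], ?_⟩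
  intro O p q δ η hδ hη st h0 h1 h2 hq
  obtain ⟨t, st', h3, h4, s, h5, h6⟩ :=
    runs_softProg O st q hδ hη h0 h1 h2 hq (le_two_pow_log p)
  exact ⟨t, st', s, h3, h4, h5, h6⟩

theorem solvesVec_top : SolvesVec ⊤ clipProg logTime := by
  refine ⟨by simp [clipProg, levelProg, buildProg, extractProg, descendProg, ascendProg, pullProg,
    Cmd.Elementary, forLoop], ?_⟩
  intro O p q δ η hδ hη st h0 h1 h2 hq
  obtain ⟨t, st', h3, h4, s, h5, h6⟩ :=
    runs_clipProg O st q hδ hη h0 h1 h2 hq (le_two_pow_log p)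
  exact ⟨t, st', s, h3, h4, h5, h6⟩

theorem isBigO_logTime : Asymptotics.IsBigO Filter.atTop (fun p : ℕ => (logTime p : ℝ))
    (fun p : ℕ => (p : ℝ) * Real.log p) := by
  refine Asymptotics.IsBigO.of_bound 1000 ?_
  -- For `p ≥ 3 > e` one has `log p ≥ 1`, which absorbs the linear and constant terms.
  filter_upwards [Filter.eventually_ge_atTop 3] with p hp
  have hp3 : (3 : ℝ) ≤ p := by exact_mod_cast hp
  have hlog1 : 1 ≤ Real.log p := by
    rw [Real.le_log_iff_exp_le (by linarith)]
    exact Real.exp_one_lt_three.le.trans hp3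
  have hlog : (Nat.log 2 p : ℝ) ≤ 2 * Real.log p := by
    have h1 : (Nat.log 2 p : ℝ) * Real.log 2 ≤ Real.log p := by
      rw [← Real.log_pow]
      apply Real.log_le_log (by positivity)
      exact_mod_cast Nat.pow_log_le_self 2 (by omega)
    have h2 := Real.log_two_gt_d9
    nlinarith [Nat.cast_nonneg (α := ℝ) (Nat.log 2 p)]
  rw [Real.norm_of_nonneg (by positivity), Real.norm_of_nonneg (by positivity), logTime]
  push_cast
  nlinarith


/-! ### The SVD call and the storage of its factors -/

theorem Runs.svd {O : Routine} {st : State} {Q : State → Prop} {m n r a u s v M N : ℕ}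
    {Y : Matrix (Fin M) (Fin N) ℝ} (hm : st.nat m = M) (hn : st.nat n = N)
    (hY : HoldsMat (st.arr a) Y) (h : Q (st.setFactors (O M N Y) r u s v)) :
    Runs O (.svd m n r a u s v) st (min (N ^ 2 * M) (M ^ 2 * N) + 1) Q := by
  subst hm hn
  have : readMat (st.arr a) (st.nat m) (st.nat n) = Y := by
    ext i j
    exact hY i j
  subst this
  exact ⟨_, _, .svd _ _ _ _ _ _ _ _, le_rfl, h⟩

theorem holdsVec_writeVec (f : ℕ → ℝ) {p : ℕ} (v : Fin p → ℝ) : HoldsVec (writeVec f v) v :=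
  fun i => by simp [writeVec]

theorem holdsMat_writeMat (f : ℕ → ℝ) {m n : ℕ} (M : Matrix (Fin m) (Fin n) ℝ) :
    HoldsMat (writeMat f M) M := by
  intro i j
  have h : ((finProdFinEquiv (i, j) : Fin (m * n)) : ℕ) = i * n + j := by
    simp [finProdFinEquiv]; ring
  have := holdsVec_writeVec f (fun t : Fin (m * n) =>
    M (finProdFinEquiv.symm t).1 (finProdFinEquiv.symm t).2) (finProdFinEquiv (i, j))
  rw [h] at this
  rw [writeMat, this]
  simp

/-! ### Multiplication of three factors

The program uses registers and arrays from `K + 2` on: the dimensions `m`, `n`, `r` are in the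
natural registers `K + 2`, `K + 3`, `K + 4`, and the factors `U`, `V`, `s` in the arrays `K + 2`,
`K + 3`, `K + 4`. -/

/-- Entry of `U diag(s) Vᵀ` from the rows of `U` and `V` that start in the cells `x` and `y`. -/
noncomputable def tripleDot (u s v : ℕ → ℝ) (r x y : ℕ) : ℝ :=
  ∑ k ∈ Finset.range r, u (x + k) * s k * v (y + k)

/-- Compute one entry of the product. -/
def dotProg (K : ℕ) : Cmd :=
  .seq (.setReal (K + 2) (.const 0)) <|
  forLoop (K + 7) (K + 4) (.setReal (K + 2) (.add (.reg (K + 2))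
    (.mul (.mul (.get (K + 2) (.add (.reg (K + 8)) (.reg (K + 7)))) (.get (K + 4) (.reg (K + 7))))
      (.get (K + 3) (.add (.reg (K + 9)) (.reg (K + 7)))))))

theorem runs_dotProg (O : Routine) (K : ℕ) (st : State) {r x y : ℕ} (hr : st.nat (K + 4) = r)
    (hx : st.nat (K + 8) = x) (hy : st.nat (K + 9) = y) :
    Runs O (dotProg K) st (r * 30 + 10) fun st' => st'.real (K + 2) =
      tripleDot (st.arr (K + 2)) (st.arr (K + 4)) (st.arr (K + 3)) r x y := by
  apply Runs.of_le
  · apply Runs.seqSetReal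
    apply Runs.forLoop (N := r) (I := fun k st₁ => st₁.real (K + 2) =
        tripleDot (st.arr (K + 2)) (st.arr (K + 4)) (st.arr (K + 3)) k x y)
    · simpa using hr
    · simp
    · simp [Cmd.natWrites]
    · simp [Cmd.natWrites]
    · simp [RExp.val, tripleDot]
    · intro k st₁ hf hk hi hI
      have h1 := hf.arr (K + 2) (by simp [forLoop, Cmd.arrWrites])
      have h2 := hf.arr (K + 3) (by simp [forLoop, Cmd.arrWrites])
      have h3 := hf.arr (K + 4) (by simp [forLoop, Cmd.arrWrites])
      have h4 := hf.nat (K + 8) (by simp [forLoop, Cmd.natWrites])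
      have h5 := hf.nat (K + 9) (by simp [forLoop, Cmd.natWrites])
      simp [hx, hy] at h1 h2 h3 h4 h5
      apply Runs.setReal
      simp [RExp.val, NExp.val, hI, hi, h1, h2, h3, h4, h5, tripleDot, Finset.sum_range_succ]
  · simp [RExp.cost, NExp.cost]
    omega

/-- Compute one row of the product. -/
def rowProg (K : ℕ) : Cmd :=
  .seq (.setNat (K + 9) (.const 0)) <|
  forLoop (K + 6) (K + 3) <|
    .seq (dotProg K) <|
    .seq (.put 1 (.reg (K + 10)) (.reg (K + 2))) <|
    .seq (.setNat (K + 10) (.add (.reg (K + 10)) (.const 1)))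
      (.setNat (K + 9) (.add (.reg (K + 9)) (.reg (K + 4))))

theorem runs_rowProg (O : Routine) (K : ℕ) (st : State) {n r x o : ℕ} (hn : st.nat (K + 3) = n)
    (hr : st.nat (K + 4) = r) (hx : st.nat (K + 8) = x) (ho : st.nat (K + 10) = o) :
    Runs O (rowProg K) st (n * (r * 30 + 40) + 10) fun st' => st'.nat (K + 10) = o + n ∧
      (∀ j < n, st'.arr 1 (o + j) =
        tripleDot (st.arr (K + 2)) (st.arr (K + 4)) (st.arr (K + 3)) r x (j * r)) ∧
      ∀ t < o, st'.arr 1 t = st.arr 1 t := by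
  apply Runs.of_le
  · apply Runs.seqSetNat
    apply Runs.imp
    · apply Runs.forLoop (N := n) (I := fun k st₁ => st₁.nat (K + 9) = k * r ∧
        st₁.nat (K + 10) = o + k ∧ (∀ j < k, st₁.arr 1 (o + j) =
          tripleDot (st.arr (K + 2)) (st.arr (K + 4)) (st.arr (K + 3)) r x (j * r)) ∧
        ∀ t < o, st₁.arr 1 t = st.arr 1 t)
      · simpa using hn
      · simp
      · simp [dotProg, forLoop, Cmd.natWrites]
      · simp [dotProg, forLoop, Cmd.natWrites]
      · simp [NExp.val, ho]
      · rintro k st₁ hf hk hi ⟨h1, h2, h3, h4⟩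
        have a1 := hf.arr (K + 2) (by simp [dotProg, forLoop, Cmd.arrWrites])
        have a2 := hf.arr (K + 3) (by simp [dotProg, forLoop, Cmd.arrWrites])
        have a3 := hf.arr (K + 4) (by simp [dotProg, forLoop, Cmd.arrWrites])
        have n1 := hf.nat (K + 4) (by simp [dotProg, forLoop, Cmd.natWrites])
        have n2 := hf.nat (K + 8) (by simp [dotProg, forLoop, Cmd.natWrites])
        simp [hr, hx] at a1 a2 a3 n1 n2
        apply Runs.seq (runs_dotProg O K st₁ n1 n2 h1)
        intro st₂ hf₂ hdot
        have a4 := hf₂.arr 1 (by simp [dotProg, forLoop, Cmd.arrWrites])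
        have n3 := hf₂.nat (K + 4) (by simp [dotProg, forLoop, Cmd.natWrites])
        have n4 := hf₂.nat (K + 9) (by simp [dotProg, forLoop, Cmd.natWrites])
        have n5 := hf₂.nat (K + 10) (by simp [dotProg, forLoop, Cmd.natWrites])
        rw [a1, a2, a3] at hdot
        apply Runs.seqPut
        apply Runs.seqSetNat
        apply Runs.setNat
        simp only [NExp.val, RExp.val, State.setNat_nat, State.setNat_arr, State.setArr_arr,
          State.setArr_nat, n3, n4, n5, n1, h1, h2, a4, hdot]
        refine ⟨by simp; ring, by simp; ring, fun j hj => ?_, fun t ht => ?_⟩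
        · by_cases hjk : j = k
          · simp [hjk]
          · simp [hjk, h3 j (by omega)]
        · have : t ≠ o + k := by omega
          simp [this, h4 t ht]
    · rintro st' _ ⟨_, h2, h3, h4⟩
      exact ⟨h2, h3, h4⟩
  · simp [NExp.cost, RExp.cost]
    ring_nf
    omega

/-- Compute the product. -/
def mulProg (K : ℕ) : Cmd :=
  .seq (.setNat (K + 8) (.const 0)) <|
  .seq (.setNat (K + 10) (.const 0)) <|
  forLoop (K + 5) (K + 2) <|
    .seq (rowProg K) (.setNat (K + 8) (.add (.reg (K + 8)) (.reg (K + 4))))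

theorem runs_mulProg (O : Routine) (K : ℕ) (st : State) {m n r : ℕ} (hm : st.nat (K + 2) = m)
    (hn : st.nat (K + 3) = n) (hr : st.nat (K + 4) = r) :
    Runs O (mulProg K) st (m * (n * (r * 30 + 40) + 30) + 10) fun st' =>
      ∀ i < m, ∀ j < n, st'.arr 1 (i * n + j) =
        tripleDot (st.arr (K + 2)) (st.arr (K + 4)) (st.arr (K + 3)) r (i * r) (j * r) := by
  apply Runs.of_le
  · apply Runs.seqSetNat
    apply Runs.seqSetNat
    apply Runs.imp
    · apply Runs.forLoop (N := m) (I := fun k st₁ => st₁.nat (K + 8) = k * r ∧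
        st₁.nat (K + 10) = k * n ∧ ∀ i < k, ∀ j < n, st₁.arr 1 (i * n + j) =
          tripleDot (st.arr (K + 2)) (st.arr (K + 4)) (st.arr (K + 3)) r (i * r) (j * r))
      · simpa using hm
      · simp
      · simp [rowProg, dotProg, forLoop, Cmd.natWrites]
      · simp [rowProg, dotProg, forLoop, Cmd.natWrites]
      · simp [NExp.val]
      · rintro k st₁ hf hk hi ⟨h1, h2, h3⟩
        have a1 := hf.arr (K + 2) (by simp [rowProg, dotProg, forLoop, Cmd.arrWrites])
        have a2 := hf.arr (K + 3) (by simp [rowProg, dotProg, forLoop, Cmd.arrWrites])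
        have a3 := hf.arr (K + 4) (by simp [rowProg, dotProg, forLoop, Cmd.arrWrites])
        have n1 := hf.nat (K + 4) (by simp [rowProg, dotProg, forLoop, Cmd.natWrites])
        have n2 := hf.nat (K + 3) (by simp [rowProg, dotProg, forLoop, Cmd.natWrites])
        simp [hr, hn] at a1 a2 a3 n1 n2
        apply Runs.seq (runs_rowProg O K st₁ n2 n1 h1 h2)
        rintro st₂ hf₂ ⟨h4, h5, h6⟩
        have n3 := hf₂.nat (K + 4) (by simp [rowProg, dotProg, forLoop, Cmd.natWrites])
        have n4 := hf₂.nat (K + 8) (by simp [rowProg, dotProg, forLoop, Cmd.natWrites])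
        rw [a1, a2, a3] at h5
        apply Runs.setNat
        simp only [NExp.val, State.setNat_nat, State.setNat_arr, n3, n4, n1, h1, h4]
        refine ⟨by simp; ring, by simp; ring, fun i hi j hj => ?_⟩
        by_cases hik : i = k
        · rw [hik, h5 j hj]
        · rw [h6, h3 i (by omega) j hj]
          -- Cells of an earlier row `i < k` lie below `k * n`, where the new row starts.
          have : (i + 1) * n ≤ k * n := Nat.mul_le_mul_right _ (by omega)
          rw [add_mul] at this
          omega
    · rintro st' _ ⟨_, _, h3⟩
      exact h3
  · simp [NExp.cost]
    ring_nf
    omega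

theorem tripleDot_eq {u s v : ℕ → ℝ} {m n r : ℕ} {U : Matrix (Fin m) (Fin r) ℝ}
    {V : Matrix (Fin n) (Fin r) ℝ} {w : Fin r → ℝ} (hu : HoldsMat u U) (hv : HoldsMat v V)
    (hs : HoldsVec s w) (i : Fin m) (j : Fin n) :
    tripleDot u s v r (i * r) (j * r) = (U * Matrix.diagonal w * V.transpose) i j := by
  rw [tripleDot, Finset.sum_range, Matrix.mul_apply]
  refine Finset.sum_congr rfl fun k _ => ?_
  rw [hu i k, hv j k, hs k, Matrix.mul_diagonal, Matrix.transpose_apply]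

/-! ### The matrix program and its running time -/

/-- Matrix program built from the vector program `P`, whose writes to natural registers and
arrays lie below `K`. -/
def matProg (P : Cmd) (K : ℕ) : Cmd :=
  .seq (.setNat (K + 2) (.reg 0)) <|
  .seq (.setNat (K + 3) (.reg 1)) <|
  -- The singular values go to array `0`, where `P` expects its input; `U` and `V` are stored out of
  -- reach of its writes.
  .seq (.svd (K + 2) (K + 3) (K + 4) 0 (K + 2) 0 (K + 3)) <|
  .seq (.setNat 0 (.reg (K + 4))) <|
  .seq P <|
  -- The output of `P` must be moved away, because the product is written to the same array `1`.
  .seq (forLoop (K + 5) (K + 4) (.put (K + 4) (.reg (K + 5)) (.get 1 (.reg (K + 5))))) <|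
  mulProg K

/-- A program text mentions finitely many cells, and the sum of a list of naturals bounds its
members. -/
theorem exists_writes_lt (P : Cmd) :
    ∃ K, (∀ i ∈ P.natWrites, i < K) ∧ ∀ i ∈ P.arrWrites, i < K := by
  have h : ∀ l : List ℕ, ∀ i ∈ l, i < l.sum + 1 := fun l i hi =>
    Nat.lt_succ_of_le (List.le_sum_of_mem hi)
  refine ⟨P.natWrites.sum + P.arrWrites.sum + 1, fun i hi => ?_, fun i hi => ?_⟩ <;>
    have := h _ i hi <;> omega

theorem runs_matProg {α : ENNReal} (hα : α = 1 ∨ α = 2 ∨ α = ⊤) {P : Cmd} {T : ℕ → ℕ}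
    (hP : SolvesVec α P T) {K : ℕ} (hKn : ∀ i ∈ P.natWrites, i < K)
    (hKa : ∀ i ∈ P.arrWrites, i < K) (O : Routine) (hO : O.Correct)
    (st : State) {m n : ℕ} {Y : Matrix (Fin m) (Fin n) ℝ} {δ η : ℝ} (hδ : 0 ≤ δ) (hη : 0 ≤ η)
    (hm : st.nat 0 = m) (hn : st.nat 1 = n) (h0 : st.real 0 = δ) (h1 : st.real 1 = η)
    (hY : HoldsMat (st.arr 0) Y) :
    Runs O (matProg P K) st (min (n ^ 2 * m) (m ^ 2 * n) + T (O m n Y).r +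
        m * (n * ((O m n Y).r * 30 + 40) + 30) + (O m n Y).r * 20 + 40) fun st' =>
      ∃ X, HoldsMat (st'.arr 1) X ∧ IsMatSol α δ η Y X := by
  have hKn' : ∀ i, K + i ∉ P.natWrites := fun i hi => by have := hKn _ hi; omega
  have hKa' : ∀ i, K + i ∉ P.arrWrites := fun i hi => by have := hKa _ hi; omega
  have hsvd := hO m n Y
  apply Runs.of_le
  · apply Runs.seqSetNat
    apply Runs.seqSetNat
    apply Runs.seq
    · refine Runs.svd (Y := Y) (M := m) (N := n) (Q := Eq _) ?_ ?_ ?_ rfl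
      · simpa [NExp.val] using hm
      · simpa [NExp.val] using hn
      · simpa using hY
    rintro _ _ rfl
    apply Runs.seqSetNat
    set F := O m n Y
    set st₁ := State.setNat (State.setFactors _ F _ _ _ _) 0 _ with hst₁
    have e1 : st₁.nat (K + 2) = m := by simp [hst₁, State.setFactors, NExp.val, hm]
    have e2 : st₁.nat (K + 3) = n := by simp [hst₁, State.setFactors, NExp.val, hn]
    have e3 : st₁.nat (K + 4) = F.r := by simp [hst₁, State.setFactors]
    have e4 : st₁.nat 0 = F.r := by simp [hst₁, State.setFactors, NExp.val]
    have e5 : st₁.real 0 = δ := by simp [hst₁, State.setFactors, h0]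
    have e6 : st₁.real 1 = η := by simp [hst₁, State.setFactors, h1]
    have e7 : HoldsVec (st₁.arr 0) F.σ := by
      simpa [hst₁, State.setFactors] using holdsVec_writeVec _ F.σ
    have e8 : HoldsMat (st₁.arr (K + 2)) F.U := by
      simpa [hst₁, State.setFactors] using holdsMat_writeMat _ F.U
    have e9 : HoldsMat (st₁.arr (K + 3)) F.V := by
      simpa [hst₁, State.setFactors] using holdsMat_writeMat _ F.V
    clear_value st₁
    obtain ⟨t, st₂', s, hex, ht, hs, hsol⟩ := hP.2 O F.r F.σ δ η hδ hη st₁ e4 e5 e6 e7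
    apply Runs.seq (R := Eq st₂') ⟨t, st₂', hex, ht, rfl⟩
    rintro st₂ hf₂ rfl
    apply Runs.seq
    · apply Runs.forLoop (N := F.r) (I := fun k st₃ => ∀ i < k, st₃.arr (K + 4) i = st₂'.arr 1 i)
      · rw [hf₂.nat _ (hKn' 4), e3]
      · simp
      · simp [Cmd.natWrites]
      · simp [Cmd.natWrites]
      · simp
      · intro k st₃ hf hk hi hI
        apply Runs.put
        have := hf.arr 1 (by simp [forLoop, Cmd.arrWrites])
        intro i hik
        by_cases h : i = k
        · simp [RExp.val, NExp.val, hi, h, this]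
        · simp [NExp.val, hi, h, hI i (by omega)]
    intro st₃ hf₃ hcopy
    have f1 := hf₃.nat (K + 2) (by simp [forLoop, Cmd.natWrites])
    have f2 := hf₃.nat (K + 3) (by simp [forLoop, Cmd.natWrites])
    have f3 := hf₃.nat (K + 4) (by simp [forLoop, Cmd.natWrites])
    have f4 := hf₃.arr (K + 2) (by simp [forLoop, Cmd.arrWrites])
    have f5 := hf₃.arr (K + 3) (by simp [forLoop, Cmd.arrWrites])
    rw [hf₂.nat _ (hKn' _)] at f1 f2 f3
    rw [hf₂.arr _ (hKa' _)] at f4 f5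
    apply Runs.imp
    · exact runs_mulProg O K st₃ (f1.trans e1) (f2.trans e2) (f3.trans e3)
    · intro st' _ hmul
      refine ⟨_, ?_, isMatSol_of_isVecSol hα hδ hsvd hsol⟩
      intro i j
      rw [hmul i i.2 j j.2]
      refine tripleDot_eq (f4 ▸ e8) (f5 ▸ e9) (fun k => ?_) i j
      rw [hcopy k k.2, hs k]
  · simp [NExp.cost, RExp.cost]
    omega

theorem le_of_transpose_mul_eq_one {m r : ℕ} {U : Matrix (Fin m) (Fin r) ℝ}
    (h : U.transpose * U = 1) : r ≤ m := by
  have h1 := Matrix.rank_mul_le_right U.transpose U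
  rw [h, Matrix.rank_one, Fintype.card_fin] at h1
  exact h1.trans (Matrix.rank_le_height U)

/-- Since `r ≤ m` and `r ≤ n`, the product cost `m * n * r` is at most `min (n²m) (m²n)`. As `m, n ≥
1`, this minimum also bounds `m * n`, `m`, `r` and `1`; the constants add up to less than 200. -/
theorem exists_solvesMat {α : ENNReal} (hα : α = 1 ∨ α = 2 ∨ α = ⊤) {P : Cmd} {T : ℕ → ℕ}
    (hP : SolvesVec α P T) : ∃ (Q : Cmd) (C : ℕ),
      SolvesMat α Q fun m n r => C * (min (n ^ 2 * m) (m ^ 2 * n) + T r) := by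
  obtain ⟨K, hKn, hKa⟩ := exists_writes_lt P
  refine ⟨matProg P K, 200, ?_⟩
  intro O hO m n Y δ η hm1 hn1 hδ hη st hm hn h0 h1 hY
  obtain ⟨t, st', hex, ht, X, hX, hsol⟩ :=
    runs_matProg hα hP hKn hKa O hO st hδ hη hm hn h0 h1 hY
  refine ⟨t, st', X, hex, ht.trans ?_, hX, hsol⟩
  have hrm := le_of_transpose_mul_eq_one (hO m n Y).left_orthonormal
  have hrn := le_of_transpose_mul_eq_one (hO m n Y).right_orthonormal
  simp only
  generalize (O m n Y).r = r at hrm hrn ⊢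
  set B := min (n ^ 2 * m) (m ^ 2 * n) with hB
  have b1 : m * n ≤ B := by
    refine le_min ?_ ?_
    · calc m * n = 1 * (m * n) := by ring
        _ ≤ n * (m * n) := Nat.mul_le_mul_right _ hn1
        _ = _ := by ring
    · calc m * n = 1 * (m * n) := by ring
        _ ≤ m * (m * n) := Nat.mul_le_mul_right _ hm1
        _ = _ := by ring
  have b2 : m * n * r ≤ B := by
    refine le_min ?_ ?_
    · calc m * n * r ≤ m * n * n := Nat.mul_le_mul_left _ hrn
        _ = _ := by ring
    · calc m * n * r ≤ m * n * m := Nat.mul_le_mul_left _ hrm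
        _ = _ := by ring
  have b3 : m ≤ m * n := Nat.le_mul_of_pos_right _ hn1
  have b4 : m * (n * (r * 30 + 40) + 30) = 30 * (m * n * r) + 40 * (m * n) + 30 * m := by ring
  omega

end RealRAM

theorem lemma3 (α : ENNReal) (hα : α = 1 ∨ α = 2 ∨ α = ⊤) :
    -- the matrix problem and the vector problem have unique solutions, and `X* = U diag(s*) Vᵀ`
    (∀ (m n r : ℕ) (δ η : ℝ), 0 ≤ δ → 0 ≤ η →
      ∀ (Y : Matrix (Fin m) (Fin n) ℝ) (U : Matrix (Fin m) (Fin r) ℝ) (σ : Fin r → ℝ)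
        (V : Matrix (Fin n) (Fin r) ℝ), IsSVD Y U σ V →
        (∃! X : Matrix (Fin m) (Fin n) ℝ, IsMatSol α δ η Y X) ∧
        (∃! s : Fin r → ℝ, IsVecSol α δ η σ s) ∧
        ∀ (X : Matrix (Fin m) (Fin n) ℝ) (s : Fin r → ℝ),
          IsMatSol α δ η Y X → IsVecSol α δ η σ s →
            X = U * Matrix.diagonal s * V.transpose) ∧
    -- `X*` is computed in `O(min(n²m, m²n) + T(r))` steps from a solver of running time `T`
    (∀ (P : RealRAM.Cmd) (T : ℕ → ℕ), RealRAM.SolvesVec α P T →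
      ∃ (Q : RealRAM.Cmd) (C : ℕ),
        RealRAM.SolvesMat α Q fun m n r => C * (min (n ^ 2 * m) (m ^ 2 * n) + T r)) ∧
    -- running times of the vector problems
    (α = 1 ∨ α = ⊤ →
      ∃ (P : RealRAM.Cmd) (T : ℕ → ℕ), RealRAM.SolvesVec α P T ∧
        Asymptotics.IsBigO Filter.atTop (fun p : ℕ => (T p : ℝ))
          (fun p : ℕ => (p : ℝ) * Real.log p)) ∧
    (α = 2 →
      ∃ (P : RealRAM.Cmd) (T : ℕ → ℕ), RealRAM.SolvesVec α P T ∧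
        Asymptotics.IsBigO Filter.atTop (fun p : ℕ => (T p : ℝ)) (fun p : ℕ => (p : ℝ))) := by
  refine ⟨?_, fun P T hP => RealRAM.exists_solvesMat hα hP, ?_, ?_⟩
  · intro m n r δ η hδ hη Y U σ V h
    have hα1 := one_le_of_cases hα
    obtain ⟨s, hs⟩ := exists_isVecSol hα1 δ hη σ
    exact ⟨⟨_, isMatSol_of_isVecSol hα hδ h hs, fun X hX => hX.eq_diagonal hα hδ h hs⟩,
      ⟨s, hs, fun t ht => ht.unique hα1 hδ hs⟩, fun X t hX ht => hX.eq_diagonal hα hδ h ht⟩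
  · rintro (rfl | rfl)
    · exact ⟨_, _, RealRAM.solvesVec_one, RealRAM.isBigO_logTime⟩
    · exact ⟨_, _, RealRAM.solvesVec_top, RealRAM.isBigO_logTime⟩
  · rintro rfl
    exact ⟨_, _, RealRAM.solvesVec_two, RealRAM.isBigO_two⟩
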